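/- **Setting.** Let $d\ge 1$, let $E$ be a finite set, and for each $i\in E$ let $F^i:\mathbb R^d\to\mathbb R^d$ be a smooth bounded vector field with flow $(\Phi^i_t)_{t\in\mathbb R}$. Let $M\subset\mathbb R^d$ be compact with $\Phi^i_t(M)\subset M$ for all $i\in E$, $t\ge 0$. For $x\in M$ and $i,j\in E$ let $\lambda(x,i,j)\ge 0$ be jump rates, continuous in $x$, with $\lambda(x,i,i)=0$ and with $(\lambda(x,i,j))_{i,j}$ irreducible for every $x\in M$. Fix $\lambda>0$ with $\sum_j\lambda(x,i,j)<\lambda$ for all $(x,i)\in M\times E$, and put $Q(x,i,j)=\lambda(x,i,j)/\lambda$ for $i\ne j$ and $Q(x,i,i)=1-\sum_{j\neq i}Q(x,i,j)$. Let $U_1,U_2,\dots$ be i.i.d. exponential random variables of parameter $\lambda$ and $T_n=U_1+\cdots+U_n$. Started at $(\tilde X_0,\tilde Y_0)=(x,i)\in M\times E$, let $\tilde X_{n+1}=\Phi^{\tilde Y_n}_{U_{n+1}}(\tilde X_n)$ and, given the past and $U_{n+1}$, let $\tilde Y_{n+1}=j$ with probability $Q(\tilde X_{n+1},\tilde Y_n,j)$.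 Set $Z_t=(\Phi^{\tilde Y_n}_{t-T_n}(\tilde X_n),\tilde Y_n)$ for $T_n\le t<T_{n+1}$, and write $\mathbb P_{x,i}$ for the law started at $(x,i)$. For indices $\mathbf i=(i_0,\dots,i_m)\in E^{m+1}$ and times $\mathbf v=(v_1,\dots,v_m)\in\mathbb R^m$ let $\mathbf\Phi^{\mathbf i}_{\mathbf v}=\Phi^{i_{m-1}}_{v_m}\circ\cdots\circ\Phi^{i_0}_{v_1}$. **Theorem (Absolute continuity, continuous case).** Let $x_0\in M$, let $\mathbf i=(i_0,\dots,i_m)\in E^{m+1}$ and $\mathbf u=(u_1,\dots,u_m)\in[0,\infty)^m$, and put $y=\mathbf\Phi^{\mathbf i}_{\mathbf u}(x_0)$. Suppose that for some $s>u_1+\cdots+u_m$ the map $$\mathbf v\mapsto \Phi^{i_m}_{s-(v_1+\cdots+v_m)}\big(\mathbf\Phi^{\mathbf i}_{\mathbf v}(x_0)\big),\qquad \mathbb R^m\to\mathbb R^d,$$ is a submersion at $\mathbf u$ (its derivative there is surjective). Let $t_0>u_1+\cdots+u_m$ and let $z=\Phi^{i_m}_{t_0-(u_1+\cdots+u_m)}(y)$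 be the endpoint at time $t_0$ of the corresponding trajectory. Then for every neighbourhood $\mathcal W$ of $z$ there are a neighbourhood $\mathcal U_0$ of $x_0$, a nonempty open set $\mathcal V\subset\mathcal W$, which contains $z$ if all $u_k$ are positive, and constants $c,\varepsilon>0$ such that $$\mathbb P_{x,i}\big(Z_t\in A\times\{j\}\big)\ \ge\ c\,\mathrm{Leb}_d(A\cap\mathcal V)$$ for all $x\in\mathcal U_0\cap M$, all $i,j\in E$, all $t\in[t_0,t_0+\varepsilon]$ and all Borel sets $A\subset\mathbb R^d$. -/

import Mathlib

open Set Filter Topology MeasureTheory ProbabilityTheory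
open scoped NNReal ENNReal ContDiff

/-! ### The flow of a smooth bounded vector field on `ℝ^d` -/

theorem lipschitzOnWith_closedBall_of_contDiff {d : ℕ}
    {F : EuclideanSpace ℝ (Fin d) → EuclideanSpace ℝ (Fin d)}
    (hF : ContDiff ℝ ∞ F) (x : EuclideanSpace ℝ (Fin d)) (r : ℝ) :
    ∃ K : ℝ≥0, LipschitzOnWith K F (Metric.closedBall x r) := by
  have hc : Continuous (fderiv ℝ F) := hF.continuous_fderiv (by simp)
  obtain ⟨C, hC⟩ := (isCompact_closedBall x r).exists_bound_of_continuousOn hc.continuousOn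
  refine ⟨C.toNNReal, (convex_closedBall x r).lipschitzOnWith_of_nnnorm_fderiv_le
    (𝕜 := ℝ) (fun y _ => (hF.differentiable (by simp)).differentiableAt) (fun y hy => ?_)⟩
  rw [← NNReal.coe_le_coe]
  exact (hC y hy).trans (Real.le_coe_toNNReal C)

theorem dist_le_of_integralCurve {d : ℕ}
    {F : EuclideanSpace ℝ (Fin d) → EuclideanSpace ℝ (Fin d)} {C : ℝ} (hC : ∀ x, ‖F x‖ ≤ C)
    {γ : ℝ → EuclideanSpace ℝ (Fin d)} {s : Set ℝ} (hs : Convex ℝ s)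
    (hγ : ∀ t ∈ s, HasDerivAt γ (F (γ t)) t) {a b : ℝ} (ha : a ∈ s) (hb : b ∈ s) :
    dist (γ b) (γ a) ≤ C * |b - a| := by
  rw [dist_eq_norm, ← Real.norm_eq_abs]
  exact hs.norm_image_sub_le_of_norm_hasDerivWithin_le
    (fun t ht => (hγ t ht).hasDerivWithinAt) (fun t _ => hC _) ha hb

/-- The Cauchy problem of a smooth bounded vector field has a global solution. -/
theorem exists_global_integralCurve {d : ℕ}
    {F : EuclideanSpace ℝ (Fin d) → EuclideanSpace ℝ (Fin d)}
    (hF : ContDiff ℝ ∞ F) (hb : ∃ C : ℝ, ∀ x, ‖F x‖ ≤ C) (x : EuclideanSpace ℝ (Fin d)) :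
    ∃ γ : ℝ → EuclideanSpace ℝ (Fin d), γ 0 = x ∧ ∀ t, HasDerivAt γ (F (γ t)) t := by
  obtain ⟨C, hC⟩ := hb
  have hC0 : 0 ≤ C := (norm_nonneg _).trans (hC x)
  have key : ∀ a : ℝ, 0 < a → ∃ γ : ℝ → EuclideanSpace ℝ (Fin d), γ 0 = x ∧
      ∀ t ∈ Ioo (-a) a, HasDerivAt γ (F (γ t)) t := by
    intro a ha
    obtain ⟨K, hK⟩ := lipschitzOnWith_closedBall_of_contDiff hF x (C * a)
    have h0 : (0 : ℝ) ∈ Icc (-a) a := ⟨by linarith, ha.le⟩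
    have hP : IsPicardLindelof (fun _ => F) (⟨0, h0⟩ : Icc (-a) a) x
        (⟨C * a, by positivity⟩ : ℝ≥0) 0 ⟨C, hC0⟩ K :=
      IsPicardLindelof.of_time_independent (fun y _ => hC y) hK (by simp; exact le_rfl)
    obtain ⟨α, h1, h2⟩ := hP.exists_eq_forall_mem_Icc_hasDerivWithinAt₀
    exact ⟨α, h1, fun t ht =>
      (h2 t (Ioo_subset_Icc_self ht)).hasDerivAt (Icc_mem_nhds ht.1 ht.2)⟩
  choose! g hg0 hg using key
  have huniq : ∀ a b : ℝ, 0 < a → a ≤ b → EqOn (g a) (g b) (Ioo (-a) a) := by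
    intro a b ha hab
    obtain ⟨K, hK⟩ := lipschitzOnWith_closedBall_of_contDiff hF x (C * a)
    have hsub : Ioo (-a) a ⊆ Ioo (-b) b := Ioo_subset_Ioo (by linarith) hab
    have h0 : (0 : ℝ) ∈ Ioo (-a) a := ⟨by linarith, ha⟩
    have hball : ∀ c : ℝ, 0 < c → Ioo (-a) a ⊆ Ioo (-c) c → ∀ t ∈ Ioo (-a) a,
        g c t ∈ Metric.closedBall x (C * a) := by
      intro c hc hac t ht
      have h := dist_le_of_integralCurve hC (convex_Ioo (-a) a)
        (fun t ht => hg c hc t (hac ht)) h0 ht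
      rw [hg0 c hc, sub_zero] at h
      exact h.trans (mul_le_mul_of_nonneg_left (abs_lt.mpr ht).le hC0)
    exact ODE_solution_unique_of_mem_Ioo (v := fun _ => F)
      (s := fun _ => Metric.closedBall x (C * a)) (fun _ _ => hK) h0
      (fun t ht => ⟨hg a ha t ht, hball a ha subset_rfl t ht⟩)
      (fun t ht => ⟨hg b (ha.trans_le hab) t (hsub ht), hball b (ha.trans_le hab) hsub t ht⟩)
      (by rw [hg0 a ha, hg0 b (ha.trans_le hab)])
  have hpos : ∀ t : ℝ, 0 < |t| + 1 := fun t => by positivity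
  refine ⟨fun t => g (|t| + 1) t, hg0 _ (hpos 0), fun t => ?_⟩
  have ht : t ∈ Ioo (-(|t| + 1)) (|t| + 1) := abs_lt.mp (lt_add_one _)
  have hev : (fun r => g (|r| + 1) r) =ᶠ[𝓝 t] g (|t| + 1) := by
    filter_upwards [Ioo_mem_nhds ht.1 ht.2] with r hr
    have hr' : r ∈ Ioo (-(|r| + 1)) (|r| + 1) := abs_lt.mp (lt_add_one _)
    rcases le_total (|r| + 1) (|t| + 1) with h | h
    · exact huniq _ _ (hpos r) h hr'
    · exact (huniq _ _ (hpos t) h hr).symm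
  exact (hg _ (hpos t) t ht).congr_of_eventuallyEq hev

open Classical in
/-- The flow of the vector field `F`: `flow F t x` is the value at time `t` of the global solution
of `γ' = F γ`, `γ 0 = x`. (For smooth bounded `F` the solution exists and is unique; where there
is no global solution the value is `x`, by convention.) -/
noncomputable def flow {d : ℕ} (F : EuclideanSpace ℝ (Fin d) → EuclideanSpace ℝ (Fin d))
    (t : ℝ) (x : EuclideanSpace ℝ (Fin d)) : EuclideanSpace ℝ (Fin d) :=
  if h : ∃ γ : ℝ → EuclideanSpace ℝ (Fin d), γ 0 = x ∧ ∀ t, HasDerivAt γ (F (γ t)) t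
    then h.choose t else x

theorem flow_spec {d : ℕ} {F : EuclideanSpace ℝ (Fin d) → EuclideanSpace ℝ (Fin d)}
    (hF : ContDiff ℝ ∞ F) (hb : ∃ C : ℝ, ∀ x, ‖F x‖ ≤ C) (x : EuclideanSpace ℝ (Fin d)) :
    flow F 0 x = x ∧ ∀ t, HasDerivAt (fun t => flow F t x) (F (flow F t x)) t := by
  have h := exists_global_integralCurve hF hb x
  have e : (fun t => flow F t x) = h.choose := by
    funext t
    simp only [flow, dif_pos h]
  refine ⟨(congrFun e 0).trans h.choose_spec.1, fun t => ?_⟩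
  have e' : flow F t x = h.choose t := congrFun e t
  rw [e, e']
  exact h.choose_spec.2 t

/-! ### The data -/

/-- The data of the switching process: finitely many smooth bounded vector fields `F i` on `ℝ^d`,
a compact set `M` that is positively invariant under all their flows, jump rates
`rate x i j` on `M`, continuous in `x`, nonnegative, zero on the diagonal and irreducible at every
point, and a constant `lam` that strictly dominates all total jump rates. -/
structure SwitchedSystem (d : ℕ) (E : Type*) [Fintype E] where
  F : E → EuclideanSpace ℝ (Fin d) → EuclideanSpace ℝ (Fin d)
  smooth : ∀ i, ContDiff ℝ ∞ (F i)
  bounded : ∃ C : ℝ, ∀ i x, ‖F i x‖ ≤ C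
  M : Set (EuclideanSpace ℝ (Fin d))
  isCompact_M : IsCompact M
  invariant : ∀ i, ∀ t : ℝ, 0 ≤ t → ∀ x ∈ M, flow (F i) t x ∈ M
  rate : M → E → E → ℝ
  rate_continuous : ∀ i j, Continuous fun x => rate x i j
  rate_nonneg : ∀ x i j, 0 ≤ rate x i j
  rate_self : ∀ x i, rate x i i = 0
  rate_irreducible : ∀ x, (Matrix.of (rate x)).IsIrreducible
  lam : ℝ
  lam_pos : 0 < lam
  sum_rate_lt : ∀ x i, ∑ j, rate x i j < lam

namespace SwitchedSystem

section

variable {d : ℕ} {E : Type*} [Fintype E] (S : SwitchedSystem d E)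

/-- The flow `Φ^i_t`. -/
noncomputable def Phi (i : E) (t : ℝ) (x : EuclideanSpace ℝ (Fin d)) :
    EuclideanSpace ℝ (Fin d) :=
  flow (S.F i) t x

/-- The composite flow `Φ^{i_{m-1}}_{u_m} ∘ ⋯ ∘ Φ^{i_0}_{u_1}` of the index sequence
`(i_0, …, i_m)` and the time sequence `(u_1, …, u_m)`. -/
noncomputable def compositeFlow : {m : ℕ} → (Fin (m + 1) → E) → (Fin m → ℝ) →
    EuclideanSpace ℝ (Fin d) → EuclideanSpace ℝ (Fin d)
  | 0, _, _, x => x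
  | m + 1, i, u, x =>
      S.Phi (i (Fin.last m).castSucc) (u (Fin.last m)) (compositeFlow (Fin.init i) (Fin.init u) x)

/-- The flow for nonnegative times, as a map of `M` to itself. -/
noncomputable def flowM (i : E) (t : ℝ≥0) (x : S.M) : S.M :=
  ⟨S.Phi i t x, S.invariant i t t.2 x x.2⟩

theorem continuous_flowM_time (i : E) (x : S.M) : Continuous fun t => S.flowM i t x := by
  have hb : ∃ C : ℝ, ∀ x, ‖S.F i x‖ ≤ C := S.bounded.imp fun C h => h i
  have h : Continuous fun t => flow (S.F i) t x :=
    continuous_iff_continuousAt.mpr fun t => ((flow_spec (S.smooth i) hb x).2 t).continuousAt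
  exact (h.comp NNReal.continuous_coe).subtype_mk _

theorem continuous_flowM_space (i : E) (t : ℝ≥0) : Continuous (S.flowM i t) := by
  have hb : ∃ C : ℝ, ∀ x, ‖S.F i x‖ ≤ C := S.bounded.imp fun C h => h i
  obtain ⟨r, hr⟩ := S.isCompact_M.isBounded.subset_closedBall 0
  obtain ⟨K, hK⟩ := lipschitzOnWith_closedBall_of_contDiff (S.smooth i) 0 r
  have hd : ∀ (x : S.M) (s : ℝ), HasDerivAt (fun t => flow (S.F i) t x)
      (S.F i (flow (S.F i) s x)) s := fun x s => (flow_spec (S.smooth i) hb x).2 s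
  have hL : LipschitzWith (Real.exp (K * t)).toNNReal (S.flowM i t) := by
    refine LipschitzWith.of_dist_le_mul fun x y => ?_
    have h := dist_le_of_trajectories_ODE_of_mem (v := fun _ => S.F i) (s := fun _ => S.M)
      (f := fun t => flow (S.F i) t x) (g := fun t => flow (S.F i) t y) (a := 0) (b := t)
      (K := K) (δ := dist x y)
      (fun _ _ => hK.mono hr) (fun s _ => (hd x s).continuousAt.continuousWithinAt)
      (fun s _ => (hd x s).hasDerivWithinAt) (fun s hs => S.invariant i s hs.1 x x.2)
      (fun s _ => (hd y s).continuousAt.continuousWithinAt)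
      (fun s _ => (hd y s).hasDerivWithinAt) (fun s hs => S.invariant i s hs.1 y y.2)
      (by rw [(flow_spec (S.smooth i) hb x).1, (flow_spec (S.smooth i) hb y).1]; rfl)
      t ⟨t.2, le_rfl⟩
    rw [sub_zero] at h
    rw [Real.coe_toNNReal _ (Real.exp_pos _).le, mul_comm]
    exact h
  exact hL.continuous

theorem measurable_move [MeasurableSpace E] [MeasurableSingletonClass E] :
    Measurable fun p : (S.M × E) × ℝ≥0 => ((S.flowM p.1.2 p.2 p.1.1, p.1.2) : S.M × E) := by
  have h : ∀ i : E, Measurable fun q : ℝ≥0 × S.M => S.flowM i q.1 q.2 := fun i =>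
    measurable_uncurry_of_continuous_of_measurable (u := fun t x => S.flowM i t x)
      (fun x => S.continuous_flowM_time i x) (fun t => (S.continuous_flowM_space i t).measurable)
  have h' : Measurable fun q : (ℝ≥0 × S.M) × E => S.flowM q.2 q.1.1 q.1.2 :=
    measurable_from_prod_countable_left fun i => h i
  exact (h'.comp ((measurable_snd.prodMk measurable_fst.fst).prodMk measurable_fst.snd)).prodMk
    measurable_fst.snd

/-! ### The embedded chain and the process -/

/-- The jump matrix `Q(x, i, j)`: `rate x i j / lam` off the diagonal, and the remaining mass on
the diagonal. -/
noncomputable def Q [DecidableEq E] (x : S.M) (i j : E) : ℝ :=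
  if i = j then 1 - ∑ k, S.rate x i k / S.lam else S.rate x i j / S.lam

theorem Q_nonneg [DecidableEq E] (x : S.M) (i j : E) : 0 ≤ S.Q x i j := by
  unfold Q
  split_ifs
  · rw [← Finset.sum_div, sub_nonneg, div_le_one S.lam_pos]
    exact (S.sum_rate_lt x i).le
  · exact div_nonneg (S.rate_nonneg x i j) S.lam_pos.le

theorem sum_Q [DecidableEq E] (x : S.M) (i : E) : ∑ j, S.Q x i j = 1 := by
  have h : ∀ j, S.Q x i j =
      (if i = j then 1 - ∑ k, S.rate x i k / S.lam else 0) + S.rate x i j / S.lam := by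
    intro j
    unfold Q
    split_ifs with hij
    · subst hij
      simp [S.rate_self]
    · simp
  simp only [h, Finset.sum_add_distrib, Finset.sum_ite_eq, Finset.mem_univ, if_true]
  ring

theorem continuous_Q [DecidableEq E] (i j : E) : Continuous fun x => S.Q x i j := by
  unfold Q
  split_ifs
  · exact continuous_const.sub
      (continuous_finsetSum _ fun k _ => (S.rate_continuous i k).div_const _)
  · exact (S.rate_continuous i j).div_const _

variable [DecidableEq E] [MeasurableSpace E] [MeasurableSingletonClass E]

/-- The jump kernel on `M × E`: from `(x, i)` to `(x, j)` with probability `Q(x, i, j)`. -/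
noncomputable def jumpKernel : Kernel (S.M × E) (S.M × E) where
  toFun z := ∑ j, ENNReal.ofReal (S.Q z.1 z.2 j) • Measure.dirac (z.1, j)
  measurable' := by
    refine Measure.measurable_of_measurable_coe _ fun A hA => ?_
    simp only [Measure.finsetSum_apply, Measure.smul_apply, smul_eq_mul]
    refine Finset.measurable_fun_sum _ fun j _ => Measurable.mul ?_ ?_
    · refine ENNReal.measurable_ofReal.comp
        (measurable_from_prod_countable_left fun i => (S.continuous_Q i j).measurable)
    · exact (Measure.measurable_coe hA).comp
        (Measure.measurable_dirac.comp (measurable_fst.prodMk measurable_const))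

instance : IsMarkovKernel S.jumpKernel where
  isProbabilityMeasure z := by
    refine ⟨?_⟩
    change (∑ j, ENNReal.ofReal (S.Q z.1 z.2 j) • Measure.dirac (z.1, j)) univ = 1
    simp only [Measure.finsetSum_apply, Measure.smul_apply, smul_eq_mul, measure_univ, mul_one]
    rw [← ENNReal.ofReal_sum_of_nonneg fun j _ => S.Q_nonneg _ _ _, S.sum_Q, ENNReal.ofReal_one]

/-- The exponential law of parameter `lam`, as a law on the nonnegative reals. -/
noncomputable def waitingLaw : Measure ℝ≥0 := (expMeasure S.lam).map Real.toNNReal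

instance : IsProbabilityMeasure S.waitingLaw := by
  have := isProbabilityMeasure_expMeasure S.lam_pos
  exact Measure.isProbabilityMeasure_map measurable_real_toNNReal.aemeasurable

/-- One step of the chain: from `(x, i)`, draw an exponential time `U` of parameter `lam`,
independent of the past, move `x` to `x' = Φ^i_U(x)`, then replace `i` by a random `j` of law
`Q(x', i, ·)`. The step returns `(U, (x', j))`. -/
noncomputable def stepKernel : Kernel (S.M × E) (ℝ≥0 × (S.M × E)) :=
  Kernel.const (S.M × E) S.waitingLaw ⊗ₖ S.jumpKernel.comap _ S.measurable_move

instance : IsMarkovKernel S.stepKernel := by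
  unfold stepKernel
  infer_instance

/-- The step kernel as a kernel on histories (it depends on the current state only). -/
noncomputable def historyKernel (n : ℕ) :
    Kernel (Π _ : Finset.Iic n, ℝ≥0 × (S.M × E)) (ℝ≥0 × (S.M × E)) :=
  S.stepKernel.comap (fun h => (h ⟨n, Finset.mem_Iic.mpr le_rfl⟩).2)
    (measurable_pi_apply _).snd

instance (n : ℕ) : IsMarkovKernel (S.historyKernel n) := by
  unfold historyKernel
  infer_instance

/-- The law `P_{x,i}` of the sequence `(U_n, (X̃_n, Ỹ_n))_{n ≥ 0}` started at `(x, i)`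
(with the convention `U_0 = 0`). -/
noncomputable def pathLaw (x : S.M) (i : E) : Measure (ℕ → ℝ≥0 × (S.M × E)) :=
  Kernel.traj S.historyKernel 0 fun _ => (0, (x, i))

end

section

variable {d : ℕ} {E : Type*} [Fintype E] (S : SwitchedSystem d E)

/-- The `n`-th jump time `T_n = U_1 + ⋯ + U_n`. -/
noncomputable def jumpTime (n : ℕ) (w : ℕ → ℝ≥0 × (S.M × E)) : ℝ≥0 :=
  ∑ k ∈ Finset.range n, (w (k + 1)).1

open Classical in
/-- The process `Z_t = (X_t, Y_t)`: for `T_n ≤ t < T_{n+1}`, `Z_t = (Φ^{Ỹ_n}_{t - T_n}(X̃_n), Ỹ_n)`.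
(When there is no such `n`, an event of probability zero, `Z_t` is the starting point.) -/
noncomputable def Z (t : ℝ≥0) (w : ℕ → ℝ≥0 × (S.M × E)) : S.M × E :=
  if h : ∃ n, S.jumpTime n w ≤ t ∧ t < S.jumpTime (n + 1) w then
    (S.flowM (w h.choose).2.2 (t - S.jumpTime h.choose w) (w h.choose).2.1, (w h.choose).2.2)
  else (w 0).2

end

end SwitchedSystem

/-- `f` is a submersion at `u`: it is differentiable there, with surjective derivative. -/
def SubmersionAt {m d : ℕ} (f : (Fin m → ℝ) → EuclideanSpace ℝ (Fin d)) (u : Fin m → ℝ) : Prop :=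
  DifferentiableAt ℝ f u ∧ Function.Surjective (fderiv ℝ f u)

/-!
For a fixed sequence of jumps up to time `t`, the sojourn times `τ` have an explicit joint density,
a product of exponential densities and of entries of `Q` along the trajectory, and the position at
time `t` is a `C¹` function of `((x, t), τ)`. Where the density is positive and this function of `τ`
is a submersion, it sends Lebesgue measure to a measure bounded below by a multiple of Lebesgue
measure, uniformly for `(x, t)` near `(x₀, t₀)`.

The jumps of the given trajectory need not have positive rates. By irreducibility, any mode is
reached from any other by jumps of positive rate, and these can be inserted with sojourn times `0`,
at the start, at every switch and at the end, without moving the position. The inserted times are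
kept fixed, and the submersion survives. The resulting `τ` lies on the boundary of the orthant, with
sum exactly `t₀`, but in the closure of the open set `K` of positive vectors of sum `< t₀`, and the
directions along which the submersion is inverted lead from `K` to admissible sojourn times.
Finally, sojourn times `u` with zero entries are first perturbed to positive ones, which is possible
because being a submersion is an open condition.
-/

section GlobalFlow

variable {E : Type*} [NormedAddCommGroup E] [NormedSpace ℝ E]

theorem norm_le_of_norm_deriv_le {g g' : ℝ → E} {K ε t : ℝ} (hK : 0 ≤ K) (hKt : K * |t| ≤ 1 / 2)
    (hg : ∀ s, |s| ≤ |t| → HasDerivAt g (g' s) s)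
    (hg' : ∀ s, |s| ≤ |t| → ‖g' s‖ ≤ K * ‖g s‖ + ε) :
    ‖g t‖ ≤ 2 * (‖g 0‖ + ε * |t|) := by
  have zero_mem : (0 : ℝ) ∈ Icc (-|t|) |t| := by simp
  obtain ⟨s, hs, hmax⟩ := isCompact_Icc.exists_isMaxOn ⟨0, zero_mem⟩ (f := fun s => ‖g s‖)
    fun s hs => (hg s (abs_le.2 hs)).continuousAt.norm.continuousWithinAt
  have hnonneg : 0 ≤ K * ‖g s‖ + ε :=
    (norm_nonneg _).trans (hg' s (abs_le.2 hs))
  have increment : ‖g s - g 0‖ ≤ (K * ‖g s‖ + ε) * ‖s - 0‖ :=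
    (convex_Icc (-|t|) |t|).norm_image_sub_le_of_norm_hasDerivWithin_le
      (fun r hr => (hg r (abs_le.2 hr)).hasDerivWithinAt)
      (fun r hr => (hg' r (abs_le.2 hr)).trans (by gcongr; exact hmax hr)) zero_mem hs
  rw [sub_zero, Real.norm_eq_abs] at increment
  have hmaximum : ‖g s‖ ≤ ‖g 0‖ + (K * ‖g s‖ + ε) * |t| := by
    have := norm_le_norm_add_norm_sub' (g s) (g 0)
    have := mul_le_mul_of_nonneg_left (abs_le.2 hs) hnonneg
    linarith
  have hts : ‖g t‖ ≤ ‖g s‖ := hmax (abs_le.1 le_rfl)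
  nlinarith [norm_nonneg (g s)]

theorem eqOn_of_hasDerivAt_of_contDiff {F : E → E} (hF : ContDiff ℝ 1 F) {s : Set ℝ}
    (hs : IsPreconnected s) (hso : IsOpen s) {γ γ' : ℝ → E} (hγ : ∀ t ∈ s, HasDerivAt γ (F (γ t)) t)
    (hγ' : ∀ t ∈ s, HasDerivAt γ' (F (γ' t)) t) {t₀ : ℝ} (ht₀ : t₀ ∈ s)
    (h₀ : γ t₀ = γ' t₀) : EqOn γ γ' s := by
  have eventuallyEq_of_eq : ∀ t ∈ s, γ t = γ' t → γ =ᶠ[𝓝 t] γ' := by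
    intro t ht h
    obtain ⟨K, u, hu, hFu⟩ := (hF.contDiffAt (x := γ t)).exists_lipschitzOnWith
    have mem_u : ∀ γ : ℝ → E, ContinuousAt γ t → u ∈ 𝓝 (γ t) → ∀ᶠ r in 𝓝 t, γ r ∈ u :=
      fun γ hγ hu => hγ.eventually_mem hu
    refine ODE_solution_unique_of_eventually (v := fun _ => F) (s := fun _ => u)
      (.of_forall fun _ => hFu) ?_ ?_ h
    · exact ((hso.eventually_mem ht).mono hγ).and (mem_u γ (hγ t ht).continuousAt hu)
    · exact ((hso.eventually_mem ht).mono hγ').and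
        (mem_u γ' (hγ' t ht).continuousAt (h ▸ hu))
  have isOpen_agree : IsOpen {r | γ =ᶠ[𝓝 r] γ'} := isOpen_setOfPred_eventually_nhds
  have agree : s ⊆ {r | γ =ᶠ[𝓝 r] γ'} := by
    refine hs.subset_of_closure_inter_subset isOpen_agree
      ⟨t₀, ht₀, eventuallyEq_of_eq t₀ ht₀ h₀⟩ fun t ht => eventuallyEq_of_eq t ht.2 ?_
    have : (𝓝[{r | γ =ᶠ[𝓝 r] γ'}] t).NeBot := mem_closure_iff_nhdsWithin_neBot.1 ht.1
    refine tendsto_nhds_unique_of_eventuallyEq (l := 𝓝[{r | γ =ᶠ[𝓝 r] γ'}] t)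
      ((hγ t ht.2).continuousAt.mono_left nhdsWithin_le_nhds)
      ((hγ' t ht.2).continuousAt.mono_left nhdsWithin_le_nhds) ?_
    filter_upwards [self_mem_nhdsWithin] with r hr using hr.self_of_nhds
  exact fun t ht => (agree ht).self_of_nhds

theorem exists_continuousOn_localFlow [CompleteSpace E] {F : E → E} {x : E}
    (hF : ContDiffAt ℝ 1 F x) :
    ∃ α : ℝ × E → E, ∃ δ > 0, ContinuousOn α (Metric.ball 0 δ ×ˢ Metric.ball x δ) ∧
      ∀ y ∈ Metric.ball x δ, α (0, y) = y ∧
        ∀ t ∈ Metric.ball 0 δ, HasDerivAt (fun s => α (s, y)) (F (α (t, y))) t := by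
  obtain ⟨ε, hε, _, r, _, _, hr, hF⟩ := IsPicardLindelof.of_contDiffAt_one hF
  obtain ⟨α, hα, hαc⟩ := (hF 0).exists_forall_mem_closedBall_eq_hasDerivWithinAt_continuousOn
  simp only [zero_sub, zero_add] at hα hαc
  have mem_Ioo : ∀ t ∈ Metric.ball (0 : ℝ) (min ε r), t ∈ Ioo (-ε) ε := fun t ht =>
    abs_lt.1 ((mem_ball_zero_iff.1 ht).trans_le (min_le_left _ _))
  have mem_closedBall : ∀ y ∈ Metric.ball x (min ε r), y ∈ Metric.closedBall x r := fun y hy =>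
    Metric.ball_subset_closedBall (Metric.ball_subset_ball (min_le_right _ _) hy)
  refine ⟨fun p => α (p.2, p.1), min ε r, lt_min hε hr, ?_, fun y hy => ?_⟩
  · exact hαc.comp (by fun_prop) fun p hp =>
      ⟨mem_closedBall p.2 hp.2, Ioo_subset_Icc_self (mem_Ioo p.1 hp.1)⟩
  · obtain ⟨h₀, hderiv⟩ := hα y (mem_closedBall y hy)
    exact ⟨h₀, fun t ht => (hderiv t (Ioo_subset_Icc_self (mem_Ioo t ht))).hasDerivAt
      (Icc_mem_nhds (mem_Ioo t ht).1 (mem_Ioo t ht).2)⟩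

theorem norm_sub_sub_fderiv_le {F : E → E} {U : Set E} {L : ℝ≥0} (hU : Convex ℝ U)
    (hF : Differentiable ℝ F) (hL : LipschitzOnWith L (fderiv ℝ F) U) {a b : E} (ha : a ∈ U)
    (hb : b ∈ U) : ‖F b - F a - fderiv ℝ F a (b - a)‖ ≤ L * ‖b - a‖ ^ 2 := by
  have hsub := hU.segment_subset ha hb
  have := (convex_segment a b).norm_image_sub_le_of_norm_hasFDerivWithin_le' (φ := fderiv ℝ F a)
    (fun z _ => (hF z).hasFDerivAt.hasFDerivWithinAt) (C := L * ‖b - a‖) (fun z hz => ?_)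
    (left_mem_segment ℝ a b) (right_mem_segment ℝ a b)
  · rwa [sq, ← mul_assoc]
  · refine (hL.norm_sub_le (hsub hz) ha).trans ?_
    gcongr
    exact norm_sub_le_of_mem_segment hz

/-- `φ` is a global flow of the vector field `F`: the curve `t ↦ φ t x` solves `γ' = F γ` on all of
`ℝ` and starts at `x`. -/
structure IsFlowOf (φ : ℝ → E → E) (F : E → E) : Prop where
  zero : ∀ x, φ 0 x = x
  hasDerivAt : ∀ x t, HasDerivAt (φ · x) (F (φ t x)) t

namespace IsFlowOf

variable {φ : ℝ → E → E} {F : E → E}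

theorem add (hφ : IsFlowOf φ F) (hF : ContDiff ℝ 1 F) (s t : ℝ) (x : E) :
    φ (s + t) x = φ s (φ t x) :=
  eqOn_of_hasDerivAt_of_contDiff hF isPreconnected_univ isOpen_univ
    (γ := fun s => φ (s + t) x)
    (fun s _ => (hφ.hasDerivAt x (s + t)).comp_add_const s t) (fun s _ => hφ.hasDerivAt _ s)
    (mem_univ 0) (by simp only [zero_add, hφ.zero]) (mem_univ s)

/-- The variational equation along the trajectories of `φ` is solved by the local flow of the field
`(x, A) ↦ (F x, F'(x) ∘ A)`, whose first component is `φ` by uniqueness. -/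
theorem exists_continuousOn_variation [CompleteSpace E] (hφ : IsFlowOf φ F) (hF : ContDiff ℝ 2 F)
    (x : E) :
    ∃ A : ℝ × E → E →L[ℝ] E, ∃ δ > 0,
      ContinuousOn (Function.uncurry φ) (Metric.ball 0 δ ×ˢ Metric.ball x δ) ∧
      ContinuousOn A (Metric.ball 0 δ ×ˢ Metric.ball x δ) ∧
      ∀ y ∈ Metric.ball x δ, A (0, y) = .id ℝ E ∧ ∀ t ∈ Metric.ball 0 δ,
        HasDerivAt (fun s => A (s, y)) ((fderiv ℝ F (φ t y)).comp (A (t, y))) t := by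
  let V : E × (E →L[ℝ] E) → E × (E →L[ℝ] E) := fun p => (F p.1, (fderiv ℝ F p.1).comp p.2)
  have hV : ContDiff ℝ 1 V :=
    ((hF.of_le one_le_two).comp contDiff_fst).prodMk
      (((hF.fderiv_right (m := 1) le_rfl).comp contDiff_fst).clm_comp contDiff_snd)
  obtain ⟨α, δ, hδ, hαc, hα⟩ := exists_continuousOn_localFlow (hV.contDiffAt (x := (x, .id ℝ E)))
  have mem_ball : ∀ y ∈ Metric.ball x δ,
      ((y, .id ℝ E) : E × (E →L[ℝ] E)) ∈ Metric.ball (x, .id ℝ E) δ := fun y hy => by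
    rw [← ball_prod_same]
    exact ⟨hy, Metric.mem_ball_self hδ⟩
  let β : ℝ × E → E × (E →L[ℝ] E) := fun p => α (p.1, (p.2, .id ℝ E))
  have hβc : ContinuousOn β (Metric.ball 0 δ ×ˢ Metric.ball x δ) :=
    hαc.comp (by fun_prop) fun p hp => ⟨hp.1, mem_ball p.2 hp.2⟩
  have hβ : ∀ y ∈ Metric.ball x δ, β (0, y) = (y, .id ℝ E) ∧
      ∀ t ∈ Metric.ball (0 : ℝ) δ, HasDerivAt (fun s => β (s, y)) (V (β (t, y))) t :=
    fun y hy => hα _ (mem_ball y hy)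
  have fst_β : ∀ y ∈ Metric.ball x δ, ∀ t ∈ Metric.ball (0 : ℝ) δ, (β (t, y)).1 = φ t y :=
    fun y hy => eqOn_of_hasDerivAt_of_contDiff (hF.of_le one_le_two)
      (convex_ball 0 δ).isPreconnected Metric.isOpen_ball
      (fun t ht => ((hβ y hy).2 t ht).fst) (fun t _ => hφ.hasDerivAt y t)
      (Metric.mem_ball_self hδ) (by rw [(hβ y hy).1, hφ.zero])
  refine ⟨fun p => (β p).2, δ, hδ, ?_, hβc.snd, fun y hy =>
    ⟨congrArg Prod.snd (hβ y hy).1, fun t ht => ?_⟩⟩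
  · exact hβc.fst.congr fun p hp => (fst_β p.2 hp.2 p.1 hp.1).symm
  · rw [← fst_β y hy t ht]
    exact ((hβ y hy).2 t ht).snd

theorem norm_sub_le {U : Set E} {K : ℝ} (hφ : IsFlowOf φ F) (hF : Differentiable ℝ F)
    (hU : Convex ℝ U) (hK : ∀ z ∈ U, ‖fderiv ℝ F z‖ ≤ K) {t : ℝ} (hKt : K * |t| ≤ 1 / 2)
    {y y' : E} (hy : ∀ s, |s| ≤ |t| → φ s y ∈ U) (hy' : ∀ s, |s| ≤ |t| → φ s y' ∈ U) :
    ‖φ t y' - φ t y‖ ≤ 2 * ‖y' - y‖ := by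
  have hK₀ : 0 ≤ K := (norm_nonneg _).trans (hK _ (hy t le_rfl))
  have := norm_le_of_norm_deriv_le (ε := 0) hK₀ hKt
    (fun s _ => (hφ.hasDerivAt y' s).sub (hφ.hasDerivAt y s)) fun s hs => by
      rw [add_zero]
      exact hU.norm_image_sub_le_of_norm_fderiv_le (fun z _ => hF z) hK (hy s hs) (hy' s hs)
  simpa only [Pi.sub_apply, hφ.zero, zero_mul, add_zero] using this

theorem norm_sub_sub_variation_le {U : Set E} {K : ℝ} {L : ℝ≥0} (hφ : IsFlowOf φ F)
    (hF : Differentiable ℝ F) (hU : Convex ℝ U) (hK : ∀ z ∈ U, ‖fderiv ℝ F z‖ ≤ K)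
    (hL : LipschitzOnWith L (fderiv ℝ F) U) {t : ℝ} (hKt : K * |t| ≤ 1 / 2) {y y' : E}
    (hy : ∀ s, |s| ≤ |t| → φ s y ∈ U) (hy' : ∀ s, |s| ≤ |t| → φ s y' ∈ U)
    {A : ℝ → E →L[ℝ] E} (hA₀ : A 0 = .id ℝ E)
    (hA : ∀ s, |s| ≤ |t| → HasDerivAt A ((fderiv ℝ F (φ s y)).comp (A s)) s) :
    ‖φ t y' - φ t y - A t (y' - y)‖ ≤ 8 * L * |t| * ‖y' - y‖ ^ 2 := by
  have hK₀ : 0 ≤ K := (norm_nonneg _).trans (hK _ (hy t le_rfl))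
  have hlip : ∀ s, |s| ≤ |t| → ‖φ s y' - φ s y‖ ≤ 2 * ‖y' - y‖ := fun s hs =>
    hφ.norm_sub_le hF hU hK ((mul_le_mul_of_nonneg_left hs hK₀).trans hKt)
      (fun r hr => hy r (hr.trans hs)) fun r hr => hy' r (hr.trans hs)
  have hderiv : ∀ s, |s| ≤ |t| → HasDerivAt (fun s => φ s y' - φ s y - A s (y' - y))
      (F (φ s y') - F (φ s y) - fderiv ℝ F (φ s y) (A s (y' - y))) s := fun s hs =>
    ((hφ.hasDerivAt y' s).sub (hφ.hasDerivAt y s)).sub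
      (by simpa using (hA s hs).clm_apply (hasDerivAt_const s (y' - y)))
  have hbound : ∀ s, |s| ≤ |t| → ‖F (φ s y') - F (φ s y) - fderiv ℝ F (φ s y) (A s (y' - y))‖ ≤
      K * ‖φ s y' - φ s y - A s (y' - y)‖ + 4 * L * ‖y' - y‖ ^ 2 := by
    intro s hs
    calc ‖F (φ s y') - F (φ s y) - fderiv ℝ F (φ s y) (A s (y' - y))‖
        = ‖fderiv ℝ F (φ s y) (φ s y' - φ s y - A s (y' - y)) +
            (F (φ s y') - F (φ s y) - fderiv ℝ F (φ s y) (φ s y' - φ s y))‖ := by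
          rw [map_sub _ (φ s y' - φ s y)]
          abel_nf
      _ ≤ K * ‖φ s y' - φ s y - A s (y' - y)‖ + L * (2 * ‖y' - y‖) ^ 2 := by
          refine (norm_add_le _ _).trans (add_le_add ?_ ?_)
          · exact (fderiv ℝ F (φ s y)).le_of_opNorm_le (hK _ (hy s hs)) _
          · refine (norm_sub_sub_fderiv_le hU hF hL (hy s hs) (hy' s hs)).trans ?_
            gcongr
            exact hlip s hs
      _ = K * ‖φ s y' - φ s y - A s (y' - y)‖ + 4 * L * ‖y' - y‖ ^ 2 := by ring
  have := norm_le_of_norm_deriv_le hK₀ hKt hderiv hbound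
  rw [hφ.zero, hφ.zero, hA₀, ContinuousLinearMap.id_apply, sub_self, norm_zero] at this
  linarith

theorem exists_forall_abs_le_mem (hφ : IsFlowOf φ F) {x : E}
    (hφc : ContinuousAt (Function.uncurry φ) (0, x)) {U : Set E} (hU : U ∈ 𝓝 x) :
    ∃ δ > 0, ∀ t ∈ Metric.ball 0 δ, ∀ y ∈ Metric.ball x δ, ∀ s, |s| ≤ |t| → φ s y ∈ U := by
  have mem_U : ∀ᶠ p in 𝓝 ((0 : ℝ), x), Function.uncurry φ p ∈ U :=
    hφc.eventually_mem (by rwa [Function.uncurry_apply_pair, hφ.zero])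
  obtain ⟨δ, hδ, hball⟩ := Metric.eventually_nhds_iff_ball.1 mem_U
  refine ⟨δ, hδ, fun t ht y hy s hs => hball (s, y) (ball_prod_same (0 : ℝ) x δ ▸ ⟨?_, hy⟩)⟩
  exact mem_ball_zero_iff.2 (hs.trans_lt (mem_ball_zero_iff.1 ht))

theorem exists_hasFDerivAt_space [CompleteSpace E] (hφ : IsFlowOf φ F) (hF : ContDiff ℝ 2 F)
    (x : E) :
    ∃ A : ℝ × E → E →L[ℝ] E, ∃ δ > 0,
      ContinuousOn (Function.uncurry φ) (Metric.ball 0 δ ×ˢ Metric.ball x δ) ∧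
      ContinuousOn A (Metric.ball 0 δ ×ˢ Metric.ball x δ) ∧
      ∀ t ∈ Metric.ball 0 δ, ∀ y ∈ Metric.ball x δ, HasFDerivAt (φ t) (A (t, y)) y := by
  obtain ⟨A, δ, hδ, hφc, hAc, hA⟩ := hφ.exists_continuousOn_variation hF x
  have hdF : ContDiff ℝ 1 (fderiv ℝ F) := hF.fderiv_right le_rfl
  obtain ⟨L, u, hu, hL⟩ := (hdF.contDiffAt (x := x)).exists_lipschitzOnWith
  have bounded : ∀ᶠ z in 𝓝 x, ‖fderiv ℝ F z‖ < ‖fderiv ℝ F x‖ + 1 :=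
    hdF.continuous.norm.continuousAt.eventually_lt_const (lt_add_one _)
  obtain ⟨ρ, hρ, hball⟩ := Metric.eventually_nhds_iff_ball.1 (bounded.and hu)
  set K := ‖fderiv ℝ F x‖ + 1
  obtain ⟨η, hη, hηball⟩ := hφ.exists_forall_abs_le_mem
    (hφc.continuousAt (prod_mem_nhds (Metric.ball_mem_nhds _ hδ) (Metric.ball_mem_nhds _ hδ)))
    (Metric.ball_mem_nhds x hρ)
  have hK₀ : 0 < K := by positivity
  let δ' := min (min δ η) (1 / (2 * K))
  have hδ' : Metric.ball (0 : ℝ) δ' ×ˢ Metric.ball x δ' ⊆ Metric.ball 0 δ ×ˢ Metric.ball x δ := by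
    gcongr <;> exact (min_le_left _ _).trans (min_le_left _ _)
  have hδη : δ' ≤ η := (min_le_left _ _).trans (min_le_right _ _)
  have mem_ball : ∀ {t y}, t ∈ Metric.ball (0 : ℝ) δ' → y ∈ Metric.ball x δ' → ∀ s, |s| ≤ |t| →
      φ s y ∈ Metric.ball x ρ := fun ht hy =>
    hηball _ (Metric.ball_subset_ball hδη ht) _ (Metric.ball_subset_ball hδη hy)
  refine ⟨A, δ', by positivity, hφc.mono hδ', hAc.mono hδ', fun t ht y hy => ?_⟩
  obtain ⟨htδ, hyδ⟩ := hδ' (mk_mem_prod ht hy)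
  have hKt : K * |t| ≤ 1 / 2 := by
    have : |t| ≤ 1 / (2 * K) := (mem_ball_zero_iff.1 ht).le.trans (min_le_right _ _)
    calc K * |t| ≤ K * (1 / (2 * K)) := by gcongr
      _ = 1 / 2 := by field_simp
  refine .of_isLittleO (Asymptotics.IsBigO.trans_isLittleO (.of_bound (8 * L * |t|) ?_)
    (Asymptotics.isLittleO_pow_sub_sub y one_lt_two))
  filter_upwards [Metric.isOpen_ball.mem_nhds hy] with y' hy'
  rw [norm_pow, norm_norm]
  exact hφ.norm_sub_sub_variation_le (hF.differentiable two_ne_zero) (convex_ball x ρ)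
    (fun z hz => (hball z hz).1.le) (hL.mono fun z hz => (hball z hz).2) hKt
    (mem_ball ht hy) (mem_ball ht hy') (hA y hyδ).1
    fun s hs => (hA y hyδ).2 s (mem_ball_zero_iff.2 (hs.trans_lt (mem_ball_zero_iff.1 htδ)))

theorem contDiffAt_zero [CompleteSpace E] (hφ : IsFlowOf φ F) (hF : ContDiff ℝ 2 F) (x : E) :
    ContDiffAt ℝ 1 (Function.uncurry φ) (0, x) := by
  obtain ⟨A, δ, hδ, hφc, hAc, hA⟩ := hφ.exists_hasFDerivAt_space hF x
  set U := Metric.ball (0 : ℝ) δ ×ˢ Metric.ball x δ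
  have hU : ∀ p ∈ U, U ∈ 𝓝 p := fun p hp =>
    (Metric.isOpen_ball.prod Metric.isOpen_ball).mem_nhds hp
  let D : ℝ × E → ℝ →L[ℝ] E := fun p => .toSpanSingleton ℝ (F (φ p.1 p.2))
  have hD : ContinuousOn D U :=
    (ContinuousLinearMap.toSpanSingletonCLE (𝕜 := ℝ) (E := E)).continuous.comp_continuousOn
      (hF.continuous.comp_continuousOn hφc)
  refine contDiffAt_one_iff.2 ⟨fun p => (D p).coprod (A p), U,
    hU (0, x) ⟨Metric.mem_ball_self hδ, Metric.mem_ball_self hδ⟩, ?_, fun p hp => ?_⟩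
  · exact hD.continuousLinearMapCoprod hAc
  · refine (hasStrictFDerivAt_uncurry_coprod (f₁ := fun t y => D (t, y))
      (f₂ := fun t y => A (t, y)) ?_ ?_ (hD.continuousAt (hU p hp))
      (hAc.continuousAt (hU p hp))).hasFDerivAt
    · exact .of_forall fun q => (hφ.hasDerivAt q.2 q.1).hasFDerivAt
    · filter_upwards [hU p hp] with q hq using hA q.1 hq.1 q.2 hq.2

theorem contDiff [CompleteSpace E] (hφ : IsFlowOf φ F) (hF : ContDiff ℝ 2 F) :
    ContDiff ℝ 1 (Function.uncurry φ) := by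
  refine contDiff_iff_contDiffAt.2 fun ⟨t, x⟩ => ?_
  have hF₁ : ContDiff ℝ 1 F := hF.of_le one_le_two
  have step : ∀ s t, ContDiffAt ℝ 1 (Function.uncurry φ) (s, x) →
      ContDiffAt ℝ 1 (Function.uncurry φ) (t - s, φ s x) →
      ContDiffAt ℝ 1 (Function.uncurry φ) (t, x) := by
    intro s t hs ht
    have hφs : ContDiffAt ℝ 1 (fun p : ℝ × E => φ s p.2) (t, x) :=
      ContDiffAt.comp (t, x) (f := fun p : ℝ × E => (s, p.2)) hs
        (contDiffAt_const.prodMk contDiffAt_snd)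
    refine (ht.comp (t, x) ((contDiffAt_fst.sub contDiffAt_const).prodMk hφs)).congr_of_eventuallyEq
      (.of_forall fun p => ?_)
    simp only [Function.comp_apply, Function.uncurry, ← hφ.add hF₁, sub_add_cancel]
  let T : Set ℝ := {t | ContDiffAt ℝ 1 (Function.uncurry φ) (t, x)}
  have near : ∀ t, ∃ V ∈ 𝓝 t, ∀ r ∈ V, ∀ s ∈ V, s ∈ T → r ∈ T := by
    intro t
    have : Tendsto (fun p : ℝ × ℝ => (p.1 - p.2, φ p.2 x)) (𝓝 t ×ˢ 𝓝 t) (𝓝 (0, φ t x)) := by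
      have hsub : Tendsto (fun p : ℝ × ℝ => p.1 - p.2) (𝓝 t ×ˢ 𝓝 t) (𝓝 0) :=
        sub_self t ▸ tendsto_fst.sub tendsto_snd
      exact hsub.prodMk_nhds ((hφ.hasDerivAt x t).continuousAt.tendsto.comp tendsto_snd)
    obtain ⟨V, hV, h⟩ := eventually_prod_self_iff
      (r := fun r s => ContDiffAt ℝ 1 (Function.uncurry φ) (r - s, φ s x)) |>.1
      (this.eventually ((hφ.contDiffAt_zero hF (φ t x)).eventually (by simp)))
    exact ⟨V, hV, fun r hr s hs hsT => step s r hsT (h r hr s hs)⟩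
  have isClopen_T : IsClopen T := by
    refine ⟨isClosed_iff_nhds.2 fun t ht => ?_, isOpen_iff_mem_nhds.2 fun t ht => ?_⟩ <;>
      obtain ⟨V, hV, h⟩ := near t
    · obtain ⟨s, hs, hsT⟩ := ht V hV
      exact h t (mem_of_mem_nhds hV) s hs hsT
    · exact mem_of_superset hV fun r hr => h r hr t (mem_of_mem_nhds hV) ht
  exact isClopen_T.eq_univ ⟨0, hφ.contDiffAt_zero hF x⟩ |>.ge (mem_univ t)

end IsFlowOf

end GlobalFlow

section LocalSubmersion

theorem eventually_closedBall_of_eventually_prod {X E : Type*} [TopologicalSpace X]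
    [SeminormedAddCommGroup E] {x₀ : X} {p : X → E → Prop}
    (h : ∀ᶠ q in 𝓝 (x₀, (0 : E)), p q.1 q.2) :
    ∀ᶠ ρ in 𝓝[>] (0 : ℝ), ∀ᶠ x in 𝓝 x₀, ∀ a ∈ Metric.closedBall 0 ρ, p x a := by
  rw [nhds_prod_eq] at h
  obtain ⟨U, hU, V, hV, hUV⟩ := eventually_prod_iff.1 h
  filter_upwards [nhdsWithin_le_nhds (eventually_closedBall_subset hV)] with ρ hρ
  filter_upwards [hU] with x hx a ha using hUV hx (hρ ha)

section Surjective

variable {W E : Type*} [NormedAddCommGroup W] [NormedSpace ℝ W] [NormedAddCommGroup E]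
  [NormedSpace ℝ E] [FiniteDimensional ℝ E]

theorem exists_continuousLinearMap_rightInverse {L : W →L[ℝ] E} (hL : Function.Surjective L) :
    ∃ R : E →L[ℝ] W, ∀ a, L (R a) = a := by
  obtain ⟨R, hR⟩ := (L : W →ₗ[ℝ] E).exists_rightInverse_of_surjective (LinearMap.range_eq_top.2 hL)
  exact ⟨R.toContinuousLinearMap, LinearMap.congr_fun hR⟩

theorem eventually_surjective {L : W →L[ℝ] E} (hL : Function.Surjective L) :
    ∀ᶠ L' : W →L[ℝ] E in 𝓝 L, Function.Surjective L' := by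
  have surjective_iff : ∀ L' : W →L[ℝ] E, Function.Surjective L' ↔
      (Module.finrank ℝ E : Cardinal) ≤ (L' : W →ₗ[ℝ] E).rank := fun L' => by
    rw [LinearMap.rank, ← Module.finrank_eq_rank, Nat.cast_le, ← ContinuousLinearMap.coe_coe,
      ← LinearMap.range_eq_top]
    exact ⟨fun h => by rw [h, finrank_top],
      fun h => Submodule.eq_top_of_finrank_eq (h.antisymm' (Submodule.finrank_le _))⟩
  simp only [surjective_iff] at hL ⊢
  exact (isOpen_setOfPred_nat_le_rank _).mem_nhds hL

end Surjective

theorem eventually_approximatesLinearOn_id {V E : Type*} [NormedAddCommGroup V] [NormedSpace ℝ V]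
    [NormedAddCommGroup E] [NormedSpace ℝ E] {G : V → E} {L : V →L[ℝ] E} {q₀ : V}
    (hG : HasStrictFDerivAt G L q₀) {R : E →L[ℝ] V} (hR : ∀ a, L (R a) = a) {δ : ℝ≥0}
    (hδ : 0 < δ) :
    ∀ᶠ ρ in 𝓝[>] (0 : ℝ), ∀ᶠ q in 𝓝 q₀,
      ApproximatesLinearOn (fun a => G (q + R a)) (.id ℝ E) (Metric.closedBall 0 ρ) δ := by
  have hcomp : (fun q : V × E × E => G (q.1 + R q.2.1) - G (q.1 + R q.2.2) - (q.2.1 - q.2.2))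
      =o[𝓝 (q₀, 0)] fun q => q.2.1 - q.2.2 := by
    have hcont : Continuous fun q : V × E × E => (q.1 + R q.2.1, q.1 + R q.2.2) := by fun_prop
    have := hG.isLittleO.comp_tendsto (hcont.tendsto' (q₀, 0) (q₀, q₀) (by simp))
    simp only [Function.comp_def, add_sub_add_left_eq_sub, ← map_sub, hR] at this
    exact this.trans_isBigO (R.isBigO_comp _ _)
  filter_upwards [eventually_closedBall_of_eventually_prod (x₀ := q₀)
    (p := fun q (a : E × E) => ‖G (q + R a.1) - G (q + R a.2) - (a.1 - a.2)‖ ≤ δ * ‖a.1 - a.2‖)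
    (hcomp.bound (NNReal.coe_pos.2 hδ))] with ρ hρ
  filter_upwards [hρ] with q hq a ha b hb
  exact hq (a, b) (closedBall_prod_same (0 : E) (0 : E) ρ ▸ mk_mem_prod ha hb)

theorem exists_ofReal_mul_le {a b : ℝ≥0∞} (ha : a ≠ 0) (ha_top : a ≠ ⊤) (hb : b ≠ 0)
    (hb_top : b ≠ ⊤) :
    ∃ c > 0, ∀ X Y : ℝ≥0∞, a * X ≤ b * Y → ENNReal.ofReal c * X ≤ Y := by
  have hab := ENNReal.div_ne_top ha_top hb
  refine ⟨(a / b).toReal, ENNReal.toReal_pos (ENNReal.div_ne_zero.2 ⟨ha, hb_top⟩) hab, ?_⟩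
  intro X Y h
  rw [ENNReal.ofReal_toReal hab, ← ENNReal.mul_div_right_comm]
  exact ENNReal.div_le_of_le_mul' h

section Measure

variable {E : Type*} [NormedAddCommGroup E] [NormedSpace ℝ E] [FiniteDimensional ℝ E]
  [MeasurableSpace E] [BorelSpace E] (ν : Measure E) [ν.IsAddHaarMeasure]

theorem eventually_half_measure_inter_ball_le :
    ∀ᶠ δ : ℝ≥0 in 𝓝[>] 0, ∀ (g : E → E) (ρ : ℝ) (z : E), 0 ≤ ρ →
      ApproximatesLinearOn g (.id ℝ E) (Metric.closedBall 0 ρ) δ → dist (g 0) z ≤ ρ / 4 →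
      ∀ A : Set E, 2⁻¹ * ν (A ∩ Metric.ball z (ρ / 4)) ≤ ν (g ⁻¹' A ∩ Metric.closedBall 0 ρ) := by
  have hdet : ENNReal.ofReal |(ContinuousLinearMap.id ℝ E).det| < (2 : ℝ≥0) := by
    simp [ContinuousLinearMap.det]
  have hhalf : ∀ᶠ δ : ℝ≥0 in 𝓝[>] 0, δ < 1 / 2 := nhdsWithin_le_nhds (Iio_mem_nhds (by positivity))
  filter_upwards [addHaar_image_le_mul_of_det_lt ν _ hdet, hhalf] with δ himage hδ g ρ z hρ hg hz A
  let inv : (ContinuousLinearMap.id ℝ E).NonlinearRightInverse :=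
    { toFun := id, nnnorm := 1, bound' := fun y => by simp, right_inv' := fun y => rfl }
  have hsurj := hg.surjOn_closedBall_of_nonlinearRightInverse inv hρ subset_rfl
  have hsub : A ∩ Metric.ball z (ρ / 4) ⊆ g '' (g ⁻¹' A ∩ Metric.closedBall 0 ρ) := by
    rintro y ⟨hyA, hy⟩
    have : y ∈ Metric.closedBall (g 0) ((((1 : ℝ≥0) : ℝ)⁻¹ - δ) * ρ) := by
      have hδ' : (δ : ℝ) < 1 / 2 := by exact_mod_cast hδ
      have := dist_triangle_right y (g 0) z
      rw [Metric.mem_ball] at hy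
      rw [Metric.mem_closedBall, NNReal.coe_one, inv_one]
      nlinarith
    obtain ⟨a, ha, rfl⟩ := hsurj this
    exact ⟨a, ⟨hyA, ha⟩, rfl⟩
  rw [mul_comm, ← div_eq_mul_inv]
  exact ENNReal.div_le_of_le_mul'
    ((measure_mono hsub).trans (himage _ _ (hg.mono_set inter_subset_right)))

variable {W : Type*} [NormedAddCommGroup W] [NormedSpace ℝ W] [FiniteDimensional ℝ W]
  [MeasurableSpace W] [BorelSpace W] (μ : Measure W) [μ.IsAddHaarMeasure]

theorem measure_mul_le_measure_mul_of_translates {f : W → E} (hf : Measurable f) (R : E →L[ℝ] W)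
    {K Ω : Set W} (hK : MeasurableSet K) {s A : Set E} (hs : MeasurableSet s)
    (hA : MeasurableSet A) (hKΩ : ∀ v ∈ K, ∀ a ∈ s, v + R a ∈ Ω) {c : ℝ≥0∞}
    (hc : ∀ v ∈ K, c ≤ ν ((fun a => f (v + R a)) ⁻¹' A ∩ s)) :
    μ K * c ≤ ν s * μ (Ω ∩ f ⁻¹' A) := by
  have : ProperSpace W := FiniteDimensional.proper_real W
  let S : Set (E × W) := {p | f (p.2 + R p.1) ∈ A}
  have hS : MeasurableSet S :=
    hf.comp (measurable_snd.add (R.continuous.measurable.comp measurable_fst)) hA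
  calc μ K * c = ∫⁻ _ in K, c ∂μ := by rw [setLIntegral_const, mul_comm]
    _ ≤ ∫⁻ v in K, ν.restrict s ((fun a => (a, v)) ⁻¹' S) ∂μ := by
      refine setLIntegral_mono' hK fun v hv => ?_
      rw [Measure.restrict_apply (measurable_prodMk_right hS)]
      exact hc v hv
    _ = ∫⁻ a in s, μ.restrict K (Prod.mk a ⁻¹' S) ∂ν := by
      rw [← Measure.prod_apply_symm hS, Measure.prod_apply hS]
    _ ≤ ∫⁻ _ in s, μ (Ω ∩ f ⁻¹' A) ∂ν := by
      refine setLIntegral_mono' hs fun a ha => ?_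
      rw [Measure.restrict_apply (measurable_prodMk_left hS),
        ← measure_preimage_add_right μ (R a) (Ω ∩ f ⁻¹' A)]
      exact measure_mono fun v hv => ⟨hKΩ v hv.2 a ha, hv.1⟩
    _ = ν s * μ (Ω ∩ f ⁻¹' A) := by rw [setLIntegral_const, mul_comm]

theorem exists_ofReal_mul_measure_inter_ball_le {P : Type*} [NormedAddCommGroup P]
    [NormedSpace ℝ P] {G : P × W → E} (hGm : ∀ p, Measurable fun v => G (p, v))
    {L : P × W →L[ℝ] E} {p₀ : P} {w₀ : W} (hG : HasStrictFDerivAt G L (p₀, w₀)) {R : E →L[ℝ] W}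
    (hR : ∀ a, L (0, R a) = a) {K Ω : Set W} (hK : IsOpen K) (hw₀ : w₀ ∈ closure K)
    (hKΩ : ∀ᶠ q in 𝓝 (w₀, (0 : E)), q.1 ∈ K → q.1 + R q.2 ∈ Ω) :
    ∃ c > 0, ∃ r > 0, ∀ᶠ p in 𝓝 p₀, ∀ A, MeasurableSet A →
      ENNReal.ofReal c * ν (A ∩ Metric.ball (G (p₀, w₀)) r) ≤
        μ (Ω ∩ (fun v => G (p, v)) ⁻¹' A) := by
  obtain ⟨δ, hδ, hδ₀⟩ :=
    ((eventually_half_measure_inter_ball_le ν).and self_mem_nhdsWithin).exists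
  have happrox := eventually_approximatesLinearOn_id hG
    (R := (ContinuousLinearMap.inr ℝ P W).comp R) hR hδ₀
  obtain ⟨ρ, ⟨hρ, hρΩ⟩, hρ₀⟩ := ((happrox.and (eventually_closedBall_of_eventually_prod
    (p := fun v a => v ∈ K → v + R a ∈ Ω) hKΩ)).and self_mem_nhdsWithin).exists
  replace hρ₀ : 0 < ρ := hρ₀
  have hnear : ∀ᶠ q in 𝓝 (p₀, w₀), dist (G q) (G (p₀, w₀)) ≤ ρ / 4 :=
    hG.continuousAt.eventually (Metric.closedBall_mem_nhds _ (by positivity))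
  have hgood := hρ.and hnear
  rw [nhds_prod_eq] at hgood
  obtain ⟨U, hU, V, hV, hUV⟩ := eventually_prod_iff.1 hgood
  have : ProperSpace W := FiniteDimensional.proper_real W
  obtain ⟨η, hη, hball⟩ := Metric.eventually_nhds_iff_ball.1 (hV.and hρΩ)
  have hKη : IsOpen (K ∩ Metric.ball w₀ η) := hK.inter Metric.isOpen_ball
  have hKη₀ : μ (K ∩ Metric.ball w₀ η) ≠ 0 :=
    (hKη.measure_pos μ (inter_comm _ K ▸
      mem_closure_iff_nhds.1 hw₀ _ (Metric.ball_mem_nhds w₀ hη))).ne'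
  have hKη_top : μ (K ∩ Metric.ball w₀ η) ≠ ⊤ :=
    measure_ne_top_of_subset inter_subset_right measure_ball_lt_top.ne
  obtain ⟨c, hc, hle⟩ := exists_ofReal_mul_le (a := μ (K ∩ Metric.ball w₀ η) * 2⁻¹)
    (mul_ne_zero hKη₀ (by simp)) (ENNReal.mul_ne_top hKη_top (by simp))
    (Metric.measure_closedBall_pos ν 0 hρ₀).ne' (measure_closedBall_lt_top (μ := ν)).ne
  refine ⟨c, hc, ρ / 4, by positivity, ?_⟩
  filter_upwards [hU] with p hp A hA
  refine hle _ _ ?_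
  rw [mul_assoc]
  refine measure_mul_le_measure_mul_of_translates ν μ (hGm p) R hKη.measurableSet
    Metric.isClosed_closedBall.measurableSet hA (fun v hv a ha => (hball v hv.2).2 a ha hv.1)
    fun v hv => ?_
  obtain ⟨hlin, hdist⟩ := hUV hp (hball v hv.2).1
  simp only [ContinuousLinearMap.comp_apply, ContinuousLinearMap.inr_apply, Prod.mk_add_mk,
    add_zero] at hlin
  exact hδ _ ρ _ hρ₀.le hlin (by simpa only [map_zero, add_zero] using hdist) A

end Measure

end LocalSubmersion

namespace SwitchedSystem

section CompositeFlow

variable {d : ℕ} {E : Type*} [Fintype E] (S : SwitchedSystem d E)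

theorem isFlowOf_Phi (i : E) : IsFlowOf (S.Phi i) (S.F i) where
  zero x := (flow_spec (S.smooth i) (S.bounded.imp fun _ h => h i) x).1
  hasDerivAt x := (flow_spec (S.smooth i) (S.bounded.imp fun _ h => h i) x).2

theorem Phi_zero (i : E) (x : EuclideanSpace ℝ (Fin d)) : S.Phi i 0 x = x :=
  (S.isFlowOf_Phi i).zero x

theorem Phi_add (i : E) (s t : ℝ) (x : EuclideanSpace ℝ (Fin d)) :
    S.Phi i (s + t) x = S.Phi i s (S.Phi i t x) :=
  (S.isFlowOf_Phi i).add (contDiff_infty.1 (S.smooth i) 1) s t x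

theorem contDiff_Phi (i : E) :
    ContDiff ℝ 1 fun p : ℝ × EuclideanSpace ℝ (Fin d) => S.Phi i p.1 p.2 :=
  (S.isFlowOf_Phi i).contDiff (contDiff_infty.1 (S.smooth i) 2)

theorem contDiff_compositeFlow {n : ℕ} (j : Fin (n + 1) → E) :
    ContDiff ℝ 1 fun p : EuclideanSpace ℝ (Fin d) × (Fin n → ℝ) =>
      S.compositeFlow j p.2 p.1 := by
  induction n with
  | zero => exact contDiff_fst
  | succ n ih =>
    have hinit : ContDiff ℝ 1 fun p : EuclideanSpace ℝ (Fin d) × (Fin (n + 1) → ℝ) =>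
        (p.1, (Fin.init p.2 : Fin n → ℝ)) :=
      contDiff_fst.prodMk (contDiff_pi.2 fun k => (contDiff_apply ℝ ℝ k.castSucc).comp contDiff_snd)
    exact (S.contDiff_Phi _).comp
      (((contDiff_apply ℝ ℝ (Fin.last n)).comp contDiff_snd).prodMk ((ih (Fin.init j)).comp hinit))

/-- The position at time `t` of the trajectory that starts at `x`, follows the modes `j` for the
sojourn times `τ` and then keeps the last mode, as a function of `((x, t), τ)`. The last flow runs
backwards when `∑ k, τ k > t`. -/
noncomputable def endpoint {n : ℕ} (j : Fin (n + 1) → E)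
    (q : (EuclideanSpace ℝ (Fin d) × ℝ) × (Fin n → ℝ)) : EuclideanSpace ℝ (Fin d) :=
  S.Phi (j (Fin.last n)) (q.1.2 - ∑ k, q.2 k) (S.compositeFlow j q.2 q.1.1)

theorem contDiff_endpoint {n : ℕ} (j : Fin (n + 1) → E) : ContDiff ℝ 1 (S.endpoint j) := by
  have hlast : ContDiff ℝ 1 fun q : (EuclideanSpace ℝ (Fin d) × ℝ) × (Fin n → ℝ) =>
      q.1.2 - ∑ k, q.2 k := by fun_prop
  exact (S.contDiff_Phi _).comp
    (hlast.prodMk ((S.contDiff_compositeFlow j).comp (contDiff_fst.fst.prodMk contDiff_snd)))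

theorem surjective_fderiv_endpoint {m : ℕ} (i : Fin (m + 1) → E) (x : EuclideanSpace ℝ (Fin d))
    {s : ℝ} (t : ℝ) {u : Fin m → ℝ}
    (h : Function.Surjective (fderiv ℝ (fun v => S.endpoint i ((x, s), v)) u)) :
    Function.Surjective (fderiv ℝ (fun v => S.endpoint i ((x, t), v)) u) := by
  have hendpoint : DifferentiableAt ℝ (fun v => S.endpoint i ((x, t), v)) u :=
    ((S.contDiff_endpoint i).comp (contDiff_prodMk_right _)).differentiable one_ne_zero u
  have hPhi : Differentiable ℝ (S.Phi (i (Fin.last m)) (s - t)) :=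
    ((S.contDiff_Phi _).comp (contDiff_prodMk_right _)).differentiable one_ne_zero
  have heq : (fun v => S.endpoint i ((x, s), v)) =
      S.Phi (i (Fin.last m)) (s - t) ∘ fun v => S.endpoint i ((x, t), v) := by
    funext v
    simp only [endpoint, Function.comp_apply, ← S.Phi_add, sub_add_sub_cancel]
  rw [heq, fderiv_comp u (hPhi _) hendpoint, ContinuousLinearMap.coe_comp] at h
  have hinj : Function.Injective (fderiv ℝ (S.Phi (i (Fin.last m)) (s - t)) _) :=
    LinearMap.injective_iff_surjective.2 h.of_comp
  exact h.of_comp_left hinj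

/-- The composite flow as a map of `M` to itself. Negative times are replaced by `0`. -/
noncomputable def compositeFlowM : {n : ℕ} → (Fin (n + 1) → E) → (Fin n → ℝ) → S.M → S.M
  | 0, _, _, x => x
  | n + 1, j, τ, x =>
      S.flowM (j (Fin.last n).castSucc) (τ (Fin.last n)).toNNReal
        (compositeFlowM (Fin.init j) (Fin.init τ) x)

theorem coe_compositeFlowM {n : ℕ} (j : Fin (n + 1) → E) {τ : Fin n → ℝ} (hτ : ∀ k, 0 ≤ τ k)
    (x : S.M) : (S.compositeFlowM j τ x : EuclideanSpace ℝ (Fin d)) = S.compositeFlow j τ x := by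
  induction n with
  | zero => rfl
  | succ n ih =>
    have h := ih (Fin.init j) (τ := Fin.init τ) fun k => hτ k.castSucc
    simp only [compositeFlowM, compositeFlow, flowM, h, Real.coe_toNNReal _ (hτ (Fin.last n))]

theorem continuous_flowM (i : E) : Continuous fun p : ℝ≥0 × S.M => S.flowM i p.1 p.2 :=
  ((S.contDiff_Phi i).continuous.comp ((NNReal.continuous_coe.comp continuous_fst).prodMk
    (continuous_subtype_val.comp continuous_snd))).subtype_mk _

theorem continuous_compositeFlowM {n : ℕ} (j : Fin (n + 1) → E) :
    Continuous fun p : S.M × (Fin n → ℝ) => S.compositeFlowM j p.2 p.1 := by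
  induction n with
  | zero => exact continuous_fst
  | succ n ih =>
    have hinit : Continuous fun p : S.M × (Fin (n + 1) → ℝ) =>
        (p.1, (Fin.init p.2 : Fin n → ℝ)) :=
      continuous_fst.prodMk (continuous_pi fun k => (continuous_apply _).comp continuous_snd)
    have hlast : Continuous fun p : S.M × (Fin (n + 1) → ℝ) => (p.2 (Fin.last n)).toNNReal :=
      continuous_real_toNNReal.comp ((continuous_apply _).comp continuous_snd)
    exact (S.continuous_flowM _).comp (hlast.prodMk ((ih (Fin.init j)).comp hinit))

end CompositeFlow

end SwitchedSystem

theorem lintegral_pi_snoc {n : ℕ} {α : Type*} [MeasurableSpace α] (μ : Fin (n + 1) → Measure α)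
    [∀ k, SigmaFinite (μ k)] {f : (Fin (n + 1) → α) → ℝ≥0∞} (hf : Measurable f) :
    ∫⁻ a, f a ∂Measure.pi μ =
      ∫⁻ a, ∫⁻ b, f (Fin.snoc (α := fun _ => α) a b) ∂μ (Fin.last n)
        ∂Measure.pi fun k : Fin n => μ k.castSucc := by
  have hmp := (measurePreserving_piFinSuccAbove μ (Fin.last n)).symm
  have hm := hf.comp hmp.measurable
  simp only [Function.comp_def] at hm
  rw [← hmp.lintegral_comp hf, lintegral_prod_symm _ hm.aemeasurable]
  simp only [Fin.succAbove_last, MeasurableEquiv.piFinSuccAbove_symm_apply]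
  exact lintegral_congr fun a => lintegral_congr fun b => congrArg f (Fin.insertNth_last' b a)

theorem setLIntegral_Ici_snoc {n : ℕ} {f : (Fin (n + 1) → ℝ) → ℝ≥0∞} (hf : Measurable f) :
    ∫⁻ τ in Ici 0, f τ =
      ∫⁻ τ : Fin n → ℝ in Ici 0, ∫⁻ u in Ici (0 : ℝ), f (Fin.snoc (α := fun _ => ℝ) τ u) := by
  have hpi (m : ℕ) : (volume : Measure (Fin m → ℝ)).restrict (Ici 0) =
      Measure.pi fun _ => volume.restrict (Ici (0 : ℝ)) := by
    rw [← Measure.restrict_pi_pi, Set.pi_univ_Ici, volume_pi]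
    rfl
  rw [hpi, hpi, lintegral_pi_snoc _ hf]

namespace SwitchedSystem

section EmbeddedChain

variable {d : ℕ} {E : Type*} [Fintype E] (S : SwitchedSystem d E)

theorem lintegral_waitingLaw {g : ℝ≥0 → ℝ≥0∞} (hg : Measurable g) :
    ∫⁻ u, g u ∂S.waitingLaw =
      ∫⁻ u in Ici (0 : ℝ), ENNReal.ofReal (S.lam * Real.exp (-(S.lam * u))) * g u.toNNReal := by
  have hpdf : Measurable (exponentialPDF S.lam) :=
    (measurable_exponentialPDFReal S.lam).ennreal_ofReal
  rw [waitingLaw, lintegral_map hg measurable_real_toNNReal]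
  change ∫⁻ u, g u.toNNReal ∂volume.withDensity (exponentialPDF S.lam) = _
  rw [lintegral_withDensity_eq_lintegral_mul (g := fun u => g u.toNNReal) _ hpdf
    (hg.comp measurable_real_toNNReal), ← lintegral_indicator measurableSet_Ici]
  refine lintegral_congr fun u => ?_
  rw [Pi.mul_apply, exponentialPDF_eq]
  by_cases hu : 0 ≤ u
  · rw [if_pos hu, indicator_of_mem (mem_Ici.2 hu)]
  · rw [if_neg hu, indicator_of_notMem (s := Ici 0) hu, ENNReal.ofReal_zero, zero_mul]

theorem waitingLaw_Ioi (t : ℝ≥0) :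
    S.waitingLaw (Ioi t) = ENNReal.ofReal (Real.exp (-(S.lam * t))) := by
  have := isProbabilityMeasure_expMeasure S.lam_pos
  have hpre : Real.toNNReal ⁻¹' Ioi t = (Iic (t : ℝ))ᶜ := by
    ext u
    simp only [mem_preimage, mem_Ioi, compl_Iic, Real.lt_toNNReal_iff_coe_lt]
  rw [waitingLaw, Measure.map_apply measurable_real_toNNReal measurableSet_Ioi, hpre,
    prob_compl_eq_one_sub measurableSet_Iic, ← ofReal_cdf, cdf_expMeasure_eq S.lam_pos,
    if_pos t.coe_nonneg, ← ENNReal.ofReal_one, ← ENNReal.ofReal_sub _ ?_, sub_sub_cancel]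
  have := S.lam_pos
  exact sub_nonneg.2 (Real.exp_le_one_iff.2 (by simp only [Left.neg_nonpos_iff]; positivity))

theorem Z_eq {n : ℕ} {t : ℝ≥0} {w : ℕ → ℝ≥0 × (S.M × E)} (h₁ : S.jumpTime n w ≤ t)
    (h₂ : t < S.jumpTime (n + 1) w) :
    S.Z t w = (S.flowM (w n).2.2 (t - S.jumpTime n w) (w n).2.1, (w n).2.2) := by
  have h : ∃ n, S.jumpTime n w ≤ t ∧ t < S.jumpTime (n + 1) w := ⟨n, h₁, h₂⟩
  have hmono : Monotone fun n => S.jumpTime n w := monotone_nat_of_le_succ fun k => by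
    simp only [jumpTime, Finset.sum_range_succ]
    exact le_self_add
  have hn : h.choose = n := by
    obtain ⟨h₃, h₄⟩ := h.choose_spec
    refine le_antisymm (not_lt.1 fun hlt => ?_) (not_lt.1 fun hlt => ?_)
    · exact (h₂.trans_le (hmono (Nat.succ_le_of_lt hlt))).not_ge h₃
    · exact (h₄.trans_le (hmono (Nat.succ_le_of_lt hlt))).not_ge h₁
  rw [Z, dif_pos h, hn]

theorem measurable_jumpTime [MeasurableSpace E] (n : ℕ) : Measurable (S.jumpTime n) :=
  Finset.measurable_fun_sum _ fun k _ => (measurable_pi_apply (k + 1)).fst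

theorem measurableSet_state [MeasurableSpace E] [MeasurableSingletonClass E] (t : ℝ≥0)
    {C : Set (S.M × E)} (hC : MeasurableSet C) :
    MeasurableSet {q : ℝ≥0 × (S.M × E) |
      q.1 ≤ t ∧ (S.flowM q.2.2 (t - q.1) q.2.1, q.2.2) ∈ C} :=
  (measurableSet_le measurable_fst measurable_const).inter
    ((S.measurable_move.comp (measurable_snd.prodMk (measurable_const.sub measurable_fst))) hC)

theorem coe_flowM_compositeFlowM_eq_endpoint (x : S.M) {n : ℕ} (j : Fin (n + 1) → E) {t : ℝ≥0}
    {τ : Fin n → ℝ} (hτ : 0 ≤ τ) (hτt : ∑ k, (τ k).toNNReal ≤ t) :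
    (S.flowM (j (Fin.last n)) (t - ∑ k, (τ k).toNNReal) (S.compositeFlowM j τ x) :
      EuclideanSpace ℝ (Fin d)) = S.endpoint j ((x, t), τ) := by
  have hsum : ((∑ k, (τ k).toNNReal : ℝ≥0) : ℝ) = ∑ k, τ k := by
    rw [NNReal.coe_sum]
    exact Finset.sum_congr rfl fun k _ => Real.coe_toNNReal _ (hτ k)
  simp only [flowM, endpoint, S.coe_compositeFlowM j hτ, NNReal.coe_sub hτt, hsum]

variable [DecidableEq E]

/-- The joint density, at the sojourn times `τ`, of the event that the embedded chain started at
`(x, j 0)` visits the modes `j` in this order: a factor `lam * exp (-lam * τ k)` for every sojourn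
and a factor `Q` for every jump. -/
noncomputable def chainDensity (x : S.M) : {n : ℕ} → (Fin (n + 1) → E) → (Fin n → ℝ) → ℝ
  | 0, _, _ => 1
  | n + 1, j, τ => chainDensity x (Fin.init j) (Fin.init τ) *
      (S.lam * Real.exp (-(S.lam * τ (Fin.last n))) *
        S.Q (S.compositeFlowM j τ x) (j (Fin.last n).castSucc) (j (Fin.last (n + 1))))

theorem chainDensity_nonneg (x : S.M) {n : ℕ} (j : Fin (n + 1) → E) (τ : Fin n → ℝ) :
    0 ≤ S.chainDensity x j τ := by
  induction n with
  | zero => exact zero_le_one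
  | succ n ih =>
    have := S.lam_pos
    exact mul_nonneg (ih _ _) (mul_nonneg (by positivity) (S.Q_nonneg _ _ _))

theorem continuous_chainDensity {n : ℕ} (j : Fin (n + 1) → E) :
    Continuous fun p : S.M × (Fin n → ℝ) => S.chainDensity p.1 j p.2 := by
  induction n with
  | zero => exact continuous_const
  | succ n ih =>
    have hinit : Continuous fun p : S.M × (Fin (n + 1) → ℝ) =>
        (p.1, (Fin.init p.2 : Fin n → ℝ)) :=
      continuous_fst.prodMk (continuous_pi fun k => (continuous_apply _).comp continuous_snd)
    have hexp : Continuous fun p : S.M × (Fin (n + 1) → ℝ) =>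
        S.lam * Real.exp (-(S.lam * p.2 (Fin.last n))) := by fun_prop
    exact ((ih (Fin.init j)).comp hinit).mul
      (hexp.mul ((S.continuous_Q _ _).comp (S.continuous_compositeFlowM j)))

variable [MeasurableSpace E]

theorem measurable_chainDensity_mul (x : S.M) {n : ℕ} (j : Fin (n + 1) → E)
    {g : ℝ≥0 × (S.M × E) → ℝ≥0∞} (hg : Measurable g) :
    Measurable fun τ => ENNReal.ofReal (S.chainDensity x j τ) *
      g (∑ k, (τ k).toNNReal, (S.compositeFlowM j τ x, j (Fin.last n))) := by
  have hpair : Continuous fun τ : Fin n → ℝ => (x, τ) := by fun_prop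
  refine ((S.continuous_chainDensity j).comp hpair).measurable.ennreal_ofReal.mul
    (hg.comp (Measurable.prodMk ?_ (Measurable.prodMk ?_ measurable_const)))
  · exact Finset.measurable_fun_sum _ fun k _ => (measurable_pi_apply k).real_toNNReal
  · exact ((S.continuous_compositeFlowM j).comp hpair).measurable

variable [MeasurableSingletonClass E]

theorem lintegral_stepKernel (x : S.M) (i : E) {g : ℝ≥0 × (S.M × E) → ℝ≥0∞} (hg : Measurable g) :
    ∫⁻ y, g y ∂S.stepKernel (x, i) = ∫⁻ u, ∑ j, ENNReal.ofReal (S.Q (S.flowM i u x) i j) *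
      g (u, (S.flowM i u x, j)) ∂S.waitingLaw := by
  rw [stepKernel, Kernel.lintegral_compProd _ _ _ hg, Kernel.const_apply]
  refine lintegral_congr fun u => ?_
  rw [Kernel.comap_apply]
  change ∫⁻ c, g (u, c) ∂(∑ j, ENNReal.ofReal (S.Q (S.flowM i u x) i j) •
    Measure.dirac (S.flowM i u x, j)) = _
  simp only [lintegral_finsetSum_measure, lintegral_smul_measure, smul_eq_mul,
    lintegral_dirac' (f := fun c => g (u, c)) _ (hg.comp measurable_prodMk_left)]

theorem lintegral_stepKernel_fst (z : S.M × E) {h : ℝ≥0 → ℝ≥0∞} (hh : Measurable h) :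
    ∫⁻ y, h y.1 ∂S.stepKernel z = ∫⁻ u, h u ∂S.waitingLaw := by
  rw [← Kernel.lintegral_fst _ _ hh, stepKernel, Kernel.fst_compProd, Kernel.const_apply]

theorem lintegral_pathLaw_succ (x : S.M) (i : E) (n : ℕ)
    {g : (ℝ≥0 × (S.M × E)) × (ℝ≥0 × (S.M × E)) → ℝ≥0∞} (hg : Measurable g) :
    ∫⁻ w, g ((S.jumpTime n w, (w n).2), w (n + 1)) ∂S.pathLaw x i =
      ∫⁻ w, ∫⁻ y, g ((S.jumpTime n w, (w n).2), y) ∂S.stepKernel (w n).2 ∂S.pathLaw x i := by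
  let state : (Π _ : Finset.Iic n, ℝ≥0 × (S.M × E)) → ℝ≥0 × (S.M × E) := fun h =>
    (∑ k : Fin n, (h ⟨k + 1, Finset.mem_Iic.2 k.2⟩).1, (h ⟨n, Finset.mem_Iic.2 le_rfl⟩).2)
  have hstate : Measurable state :=
    (Finset.measurable_fun_sum _ fun k _ => (measurable_pi_apply _).fst).prodMk
      (measurable_pi_apply _).snd
  have hstate_restrict (w : ℕ → ℝ≥0 × (S.M × E)) :
      state (Preorder.frestrictLe (π := fun _ => ℝ≥0 × (S.M × E)) n w) =
        (S.jumpTime n w, (w n).2) := by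
    simp only [state, jumpTime, Finset.sum_range]
    rfl
  have hf : Measurable fun q : (Π _ : Finset.Iic n, ℝ≥0 × (S.M × E)) × (ℝ≥0 × (S.M × E)) =>
      g (state q.1, q.2) := hg.comp ((hstate.comp measurable_fst).prodMk measurable_snd)
  have hr : Measurable (Preorder.frestrictLe (π := fun _ : ℕ => ℝ≥0 × (S.M × E)) n) :=
    Preorder.measurable_frestrictLe n
  have h := congrArg (fun ν => ∫⁻ q, g (state q.1, q.2) ∂ν) <|
    Kernel.partialTraj_compProd_eq_map_traj (X := fun _ => ℝ≥0 × (S.M × E))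
      (κ := S.historyKernel) (Nat.zero_le n) (x₀ := fun _ => ((0 : ℝ≥0), (x, i)))
  rw [lintegral_map hf (hr.prodMk (measurable_pi_apply _)), Measure.lintegral_compProd hf,
    ← Kernel.traj_map_frestrictLe_apply,
    lintegral_map (hf.lintegral_kernel_prod_right' (κ := S.historyKernel n)) hr] at h
  simp only [hstate_restrict] at h
  exact h.symm

theorem lintegral_pathLaw_zero (x : S.M) (i : E) {g : S.M × E → ℝ≥0∞} (hg : Measurable g) :
    ∫⁻ w, g (w 0).2 ∂S.pathLaw x i = g (x, i) := by
  have hf : Measurable fun h : Π _ : Finset.Iic 0, ℝ≥0 × (S.M × E) =>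
      g (h ⟨0, Finset.mem_Iic.2 le_rfl⟩).2 := hg.comp (measurable_pi_apply _).snd
  have h := congrArg (fun ν => ∫⁻ h, g (h ⟨0, Finset.mem_Iic.2 le_rfl⟩).2 ∂ν) <|
    Kernel.traj_map_frestrictLe_apply (X := fun _ => ℝ≥0 × (S.M × E)) (κ := S.historyKernel) 0 0
      (fun _ => ((0 : ℝ≥0), (x, i)))
  rw [Kernel.partialTraj_self, Kernel.id_apply,
    lintegral_map hf (Preorder.measurable_frestrictLe 0), lintegral_dirac' _ hf] at h
  exact h

theorem setLIntegral_waitingTime_le_lintegral_stepKernel (x : S.M) (i j : E)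
    {g : ℝ≥0 × (S.M × E) → ℝ≥0∞} (hg : Measurable g) :
    ∫⁻ u in Ici (0 : ℝ), ENNReal.ofReal (S.lam * Real.exp (-(S.lam * u)) *
        S.Q (S.flowM i u.toNNReal x) i j) * g (u.toNNReal, (S.flowM i u.toNNReal x, j)) ≤
      ∫⁻ y, g y ∂S.stepKernel (x, i) := by
  have hflow : Continuous fun u => S.flowM i u x := S.continuous_flowM_time i x
  have hm (j : E) : Measurable fun u => ENNReal.ofReal (S.Q (S.flowM i u x) i j) *
      g (u, (S.flowM i u x, j)) :=
    ((S.continuous_Q i j).comp hflow).measurable.ennreal_ofReal.mul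
      (hg.comp (measurable_id.prodMk (hflow.measurable.prodMk measurable_const)))
  rw [S.lintegral_stepKernel x i hg,
    S.lintegral_waitingLaw (Finset.measurable_fun_sum _ fun j _ => hm j)]
  have hlam := S.lam_pos
  refine lintegral_mono fun u => ?_
  rw [ENNReal.ofReal_mul (by positivity), mul_assoc]
  gcongr
  exact Finset.single_le_sum (f := fun j => ENNReal.ofReal (S.Q (S.flowM i u.toNNReal x) i j) *
    g (u.toNNReal, (S.flowM i u.toNNReal x, j))) (fun _ _ => zero_le) (Finset.mem_univ j)

theorem setLIntegral_chainDensity_le_lintegral_pathLaw (x : S.M) {n : ℕ} (j : Fin (n + 1) → E)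
    {g : ℝ≥0 × (S.M × E) → ℝ≥0∞} (hg : Measurable g) :
    ∫⁻ τ in Ici 0, ENNReal.ofReal (S.chainDensity x j τ) *
        g (∑ k, (τ k).toNNReal, (S.compositeFlowM j τ x, j (Fin.last n))) ≤
      ∫⁻ w, g (S.jumpTime n w, (w n).2) ∂S.pathLaw x (j 0) := by
  induction n generalizing g with
  | zero =>
    simp only [jumpTime, Finset.sum_range_zero]
    rw [S.lintegral_pathLaw_zero x (j 0) (g := fun z => g (0, z)) (hg.comp measurable_prodMk_left),
      Measure.volume_pi_eq_dirac 0]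
    refine (setLIntegral_le_lintegral _ _).trans ?_
    rw [lintegral_dirac]
    simp only [chainDensity, compositeFlowM, ENNReal.ofReal_one, one_mul, Finset.univ_eq_empty,
      Finset.sum_empty]
    rfl
  | succ n ih =>
    have hadd : Measurable fun q : (ℝ≥0 × (S.M × E)) × (ℝ≥0 × (S.M × E)) =>
        g (q.1.1 + q.2.1, q.2.2) :=
      hg.comp ((measurable_fst.fst.add measurable_snd.fst).prodMk measurable_snd.snd)
    have hstep : Measurable fun q : ℝ≥0 × (S.M × E) =>
        ∫⁻ y, g (q.1 + y.1, y.2) ∂S.stepKernel q.2 :=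
      hadd.lintegral_kernel_prod_right' (κ := S.stepKernel.comap Prod.snd measurable_snd)
    calc _ ≤ ∫⁻ τ in Ici 0, ENNReal.ofReal (S.chainDensity x (Fin.init j) τ) *
          ∫⁻ y, g (∑ k, (τ k).toNNReal + y.1, y.2)
            ∂S.stepKernel (S.compositeFlowM (Fin.init j) τ x, Fin.init j (Fin.last n)) := by
          rw [setLIntegral_Ici_snoc (S.measurable_chainDensity_mul x j hg)]
          refine lintegral_mono fun τ => ?_
          simp only [chainDensity, compositeFlowM, Fin.init_snoc, Fin.snoc_last,
            Fin.sum_univ_castSucc, Fin.snoc_castSucc,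
            ENNReal.ofReal_mul (S.chainDensity_nonneg _ _ _), mul_assoc (ENNReal.ofReal _)]
          rw [lintegral_const_mul' _ _ ENNReal.ofReal_ne_top]
          gcongr
          exact S.setLIntegral_waitingTime_le_lintegral_stepKernel _ _ _
            (hg.comp ((measurable_const.add measurable_fst).prodMk measurable_snd))
      _ ≤ _ := ih (Fin.init j) hstep
      _ = _ := by
          rw [show Fin.init j 0 = j 0 from rfl, ← S.lintegral_pathLaw_succ x (j 0) n hadd]
          simp only [jumpTime, Finset.sum_range_succ]

theorem lintegral_pathLaw_mul_waitingTime (x : S.M) (i : E) (n : ℕ)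
    {f : ℝ≥0 × (S.M × E) → ℝ≥0∞} (hf : Measurable f) {h : ℝ≥0 → ℝ≥0∞} (hh : Measurable h) :
    ∫⁻ w, f (S.jumpTime n w, (w n).2) * h (w (n + 1)).1 ∂S.pathLaw x i =
      (∫⁻ w, f (S.jumpTime n w, (w n).2) ∂S.pathLaw x i) * ∫⁻ u, h u ∂S.waitingLaw := by
  have hstate : Measurable fun w : ℕ → ℝ≥0 × (S.M × E) => f (S.jumpTime n w, (w n).2) :=
    hf.comp ((S.measurable_jumpTime n).prodMk (measurable_pi_apply n).snd)
  have hh₁ : Measurable fun y : ℝ≥0 × (S.M × E) => h y.1 := hh.comp measurable_fst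
  rw [S.lintegral_pathLaw_succ x i n (g := fun q => f q.1 * h q.2.1)
    ((hf.comp measurable_fst).mul (hh₁.comp measurable_snd)), ← lintegral_mul_const _ hstate]
  simp only [lintegral_const_mul _ hh₁, S.lintegral_stepKernel_fst _ hh]

theorem pathLaw_inter_waitingTime (x : S.M) (i : E) (n : ℕ) {B : Set (ℝ≥0 × (S.M × E))}
    (hB : MeasurableSet B) {C : Set ℝ≥0} (hC : MeasurableSet C) :
    S.pathLaw x i {w | (S.jumpTime n w, (w n).2) ∈ B ∧ (w (n + 1)).1 ∈ C} =
      S.pathLaw x i {w | (S.jumpTime n w, (w n).2) ∈ B} * S.waitingLaw C := by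
  have hstate : MeasurableSet {w : ℕ → ℝ≥0 × (S.M × E) | (S.jumpTime n w, (w n).2) ∈ B} :=
    ((S.measurable_jumpTime n).prodMk (measurable_pi_apply n).snd) hB
  have hwait : MeasurableSet {w : ℕ → ℝ≥0 × (S.M × E) | (w (n + 1)).1 ∈ C} :=
    (measurable_pi_apply (n + 1)).fst hC
  have h := S.lintegral_pathLaw_mul_waitingTime x i n (f := B.indicator 1) (h := C.indicator 1)
    (measurable_one.indicator hB) (measurable_one.indicator hC)
  rw [lintegral_indicator_one hC] at h
  rw [← lintegral_indicator_one hstate]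
  refine (lintegral_indicator_one (hstate.inter hwait)).symm.trans ?_
  rw [inter_indicator_one]
  exact h

theorem exp_mul_pathLaw_le_pathLaw_Z (x : S.M) (i : E) (n : ℕ) (t : ℝ≥0) {C : Set (S.M × E)}
    (hC : MeasurableSet C) :
    ENNReal.ofReal (Real.exp (-(S.lam * t))) * S.pathLaw x i {w | S.jumpTime n w ≤ t ∧
        (S.flowM (w n).2.2 (t - S.jumpTime n w) (w n).2.1, (w n).2.2) ∈ C} ≤
      S.pathLaw x i {w | S.Z t w ∈ C} := by
  rw [← S.waitingLaw_Ioi, mul_comm]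
  refine (S.pathLaw_inter_waitingTime x i n (S.measurableSet_state t hC)
    measurableSet_Ioi).ge.trans (measure_mono ?_)
  rintro w ⟨⟨hle, hmem⟩, hlt⟩
  have hlt' : t < S.jumpTime (n + 1) w := by
    rw [jumpTime, Finset.sum_range_succ]
    exact (mem_Ioi.1 hlt).trans_le le_add_self
  rwa [mem_ofPred_eq, S.Z_eq hle hlt']

theorem setLIntegral_chainDensity_le_pathLaw_Z (x : S.M) {n : ℕ} (j : Fin (n + 1) → E) (t : ℝ≥0)
    {A : Set (EuclideanSpace ℝ (Fin d))} (hA : MeasurableSet A) :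
    ENNReal.ofReal (Real.exp (-(S.lam * t))) *
        ∫⁻ τ in {τ : Fin n → ℝ | 0 ≤ τ ∧ ∑ k, τ k ≤ t} ∩
            (fun τ => S.endpoint j ((x, t), τ)) ⁻¹' A,
          ENNReal.ofReal (S.chainDensity x j τ) ≤
      S.pathLaw x (j 0) {w | ((S.Z t w).1 : EuclideanSpace ℝ (Fin d)) ∈ A ∧
        (S.Z t w).2 = j (Fin.last n)} := by
  let C : Set (S.M × E) := {z | (z.1 : EuclideanSpace ℝ (Fin d)) ∈ A ∧ z.2 = j (Fin.last n)}
  let B : Set (ℝ≥0 × (S.M × E)) :=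
    {q | q.1 ≤ t ∧ (S.flowM q.2.2 (t - q.1) q.2.1, q.2.2) ∈ C}
  have hC : MeasurableSet C :=
    ((measurable_subtype_coe.comp measurable_fst) hA).inter
      (measurable_snd (measurableSet_singleton _))
  have hB : MeasurableSet B := S.measurableSet_state t hC
  have hstate : Measurable fun w : ℕ → ℝ≥0 × (S.M × E) => (S.jumpTime n w, (w n).2) :=
    (S.measurable_jumpTime n).prodMk (measurable_pi_apply n).snd
  have hcont : Continuous fun τ : Fin n → ℝ => S.endpoint j ((x, t), τ) :=
    (S.contDiff_endpoint j).continuous.comp (by fun_prop)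
  have hnonneg : MeasurableSet {τ : Fin n → ℝ | 0 ≤ τ} := measurableSet_Ici
  have hsum : MeasurableSet {τ : Fin n → ℝ | ∑ k, τ k ≤ t} :=
    measurableSet_le (by fun_prop) measurable_const
  have hD : MeasurableSet ({τ : Fin n → ℝ | 0 ≤ τ ∧ ∑ k, τ k ≤ t} ∩
      (fun τ => S.endpoint j ((x, t), τ)) ⁻¹' A) :=
    (hnonneg.inter hsum).inter (hcont.measurable hA)
  refine le_trans ?_ (S.exp_mul_pathLaw_le_pathLaw_Z x (j 0) n t hC)
  gcongr
  calc _ ≤ ∫⁻ τ in {τ : Fin n → ℝ | 0 ≤ τ ∧ ∑ k, τ k ≤ t} ∩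
            (fun τ => S.endpoint j ((x, t), τ)) ⁻¹' A, ENNReal.ofReal (S.chainDensity x j τ) *
          B.indicator 1 (∑ k, (τ k).toNNReal, (S.compositeFlowM j τ x, j (Fin.last n))) := by
        refine setLIntegral_mono' hD fun τ ⟨⟨hτ, hτt⟩, hτA⟩ => ?_
        have hτt' : ∑ k, (τ k).toNNReal ≤ t := by
          rw [← NNReal.coe_le_coe, NNReal.coe_sum]
          simpa only [Real.coe_toNNReal _ (hτ _)] using hτt
        rw [indicator_of_mem, Pi.one_apply, mul_one]
        refine ⟨hτt', ?_, rfl⟩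
        rwa [S.coe_flowM_compositeFlowM_eq_endpoint x j hτ hτt']
    _ ≤ _ := lintegral_mono_set fun _ hτ => hτ.1.1
    _ ≤ _ := S.setLIntegral_chainDensity_le_lintegral_pathLaw x j (measurable_one.indicator hB)
    _ = _ := lintegral_indicator_one (hstate hB)

end EmbeddedChain

end SwitchedSystem

theorem exists_continuousLinearMap_snoc {V : Type*} [NormedAddCommGroup V] [NormedSpace ℝ V]
    {n : ℕ} (D : V →L[ℝ] (Fin n → ℝ)) (l : V →L[ℝ] ℝ) :
    ∃ D' : V →L[ℝ] (Fin (n + 1) → ℝ), ∀ w, D' w = Fin.snoc (D w) (l w) := by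
  refine ⟨ContinuousLinearMap.pi (Fin.snoc (α := fun _ => V →L[ℝ] ℝ)
    (fun k => (ContinuousLinearMap.proj k).comp D) l), fun w => funext fun k => ?_⟩
  refine Fin.lastCases ?_ (fun k => ?_) k
  · simp only [ContinuousLinearMap.pi_apply, Fin.snoc_last]
  · simp only [ContinuousLinearMap.pi_apply, Fin.snoc_castSucc, ContinuousLinearMap.comp_apply,
      ContinuousLinearMap.proj_apply]

theorem snoc_add_snoc {n : ℕ} (a b : Fin n → ℝ) (s t : ℝ) :
    (Fin.snoc a s + Fin.snoc b t : Fin (n + 1) → ℝ) = Fin.snoc (a + b) (s + t) := by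
  funext k
  refine Fin.lastCases ?_ (fun k => ?_) k
  · simp only [Pi.add_apply, Fin.snoc_last]
  · simp only [Pi.add_apply, Fin.snoc_castSucc]

namespace SwitchedSystem

section Reaches

variable {d : ℕ} {E : Type*} [Fintype E] [DecidableEq E] (S : SwitchedSystem d E)

theorem Q_self_pos (x : S.M) (i : E) : 0 < S.Q x i i := by
  rw [Q, if_pos rfl, ← Finset.sum_div, sub_pos, div_lt_one S.lam_pos]
  exact S.sum_rate_lt x i

theorem Q_pos_of_rate_pos {x : S.M} {i j : E} (h : 0 < S.rate x i j) : 0 < S.Q x i j := by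
  have hij : i ≠ j := by
    rintro rfl
    exact h.ne' (S.rate_self x i)
  rw [Q, if_neg hij]
  exact div_pos h S.lam_pos

variable {V : Type*} [NormedAddCommGroup V] [NormedSpace ℝ V]

/-- A family of trajectories, parametrized by `w : V`, that share one sequence of jumps leading
from the mode `j₀` to the mode `j₁`, has positive density at `w = 0`, and leads from `x₀` to `f w`
in time `σ w`. The sojourn times are affine in `w`, and only those that are positive at `w = 0`
may vary. -/
def Reaches (x₀ : S.M) (j₀ j₁ : E) (f : V → EuclideanSpace ℝ (Fin d)) (σ : V → ℝ) : Prop :=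
  ∃ (n : ℕ) (j : Fin (n + 1) → E) (τ : Fin n → ℝ) (D : V →L[ℝ] (Fin n → ℝ)),
    j 0 = j₀ ∧ j (Fin.last n) = j₁ ∧ (∀ k, 0 ≤ τ k) ∧ (∀ k, τ k = 0 → ∀ w, D w k = 0) ∧
      0 < S.chainDensity x₀ j τ ∧ (∀ w, S.compositeFlow j (τ + D w) x₀ = f w) ∧
      ∀ w, ∑ k, (τ + D w) k = σ w

namespace Reaches

variable {S} {x₀ : S.M} {j₀ j₁ : E} {f : V → EuclideanSpace ℝ (Fin d)} {σ : V → ℝ}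

theorem refl : S.Reaches x₀ j₀ j₀ (fun _ : V => (x₀ : EuclideanSpace ℝ (Fin d))) fun _ => 0 :=
  ⟨0, fun _ => j₀, 0, 0, rfl, rfl, fun _ => le_rfl, fun _ _ _ => rfl, one_pos, fun _ => rfl,
    fun _ => Finset.sum_of_isEmpty _⟩

theorem mem (h : S.Reaches x₀ j₀ j₁ f σ) : f 0 ∈ S.M := by
  obtain ⟨n, j, τ, D, -, -, hτ, -, -, hf, -⟩ := h
  rw [← hf 0, map_zero, add_zero, ← S.coe_compositeFlowM j hτ]
  exact Subtype.coe_prop _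

theorem step (h : S.Reaches x₀ j₀ j₁ f σ) {a : ℝ} (ha : 0 ≤ a) {l : V →L[ℝ] ℝ}
    (hl : a = 0 → l = 0) {j₂ : E} (hQ : 0 < S.Q (S.flowM j₁ a.toNNReal ⟨f 0, h.mem⟩) j₁ j₂) :
    S.Reaches x₀ j₀ j₂ (fun w => S.Phi j₁ (a + l w) (f w)) fun w => σ w + (a + l w) := by
  obtain ⟨n, j, τ, D, hj₀, hj₁, hτ, hD, hdens, hf, hσ⟩ := id h
  obtain ⟨D', hD'⟩ := exists_continuousLinearMap_snoc D l
  have hx : S.compositeFlowM j τ x₀ = ⟨f 0, h.mem⟩ := by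
    have hf₀ := hf 0
    rw [map_zero, add_zero, ← S.coe_compositeFlowM j hτ] at hf₀
    exact Subtype.ext hf₀
  refine ⟨n + 1, Fin.snoc j j₂, Fin.snoc τ a, D', ?_, Fin.snoc_last _ _, ?_, ?_, ?_,
    fun w => ?_, fun w => ?_⟩
  · rw [← hj₀, ← Fin.castSucc_zero, Fin.snoc_castSucc]
  · refine Fin.lastCases ?_ fun k => ?_
    · rwa [Fin.snoc_last]
    · rw [Fin.snoc_castSucc]
      exact hτ k
  · refine Fin.lastCases (fun h₀ w => ?_) fun k h₀ w => ?_
    · rw [Fin.snoc_last] at h₀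
      rw [hD', Fin.snoc_last, hl h₀, zero_apply]
    · rw [Fin.snoc_castSucc] at h₀
      rw [hD', Fin.snoc_castSucc, hD k h₀]
  · simp only [chainDensity, compositeFlowM, Fin.init_snoc, Fin.snoc_last, Fin.snoc_castSucc]
    rw [hx, hj₁]
    have := S.lam_pos
    positivity
  · rw [hD', snoc_add_snoc]
    simp only [compositeFlow, Fin.init_snoc, Fin.snoc_last, Fin.snoc_castSucc, hf, hj₁]
  · rw [hD', snoc_add_snoc, Fin.sum_univ_castSucc]
    simp only [Fin.snoc_last, Fin.snoc_castSucc, hσ]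

theorem wait (h : S.Reaches x₀ j₀ j₁ f σ) {a : ℝ} (ha : 0 < a) (l : V →L[ℝ] ℝ) :
    S.Reaches x₀ j₀ j₁ (fun w => S.Phi j₁ (a + l w) (f w)) fun w => σ w + (a + l w) :=
  h.step ha.le (fun h₀ => absurd h₀ ha.ne') (S.Q_self_pos _ _)

/-- The jumps along a path of positive rates at the point `f 0` are made without waiting. -/
theorem switch (h : S.Reaches x₀ j₀ j₁ f σ) (j₂ : E) : S.Reaches x₀ j₀ j₂ f σ := by
  let _ : Quiver E := Matrix.toQuiver (Matrix.of (S.rate ⟨f 0, h.mem⟩))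
  obtain ⟨path, -⟩ := (S.rate_irreducible ⟨f 0, h.mem⟩).connected j₁ j₂
  induction path with
  | nil => exact h
  | @cons b c _ edge ih =>
    have hflow : S.flowM b (0 : ℝ).toNNReal ⟨f 0, ih.mem⟩ = ⟨f 0, h.mem⟩ := by
      refine Subtype.ext ?_
      simp only [flowM, Real.toNNReal_zero, NNReal.coe_zero, S.Phi_zero]
    have hstep := ih.step (a := 0) le_rfl (l := 0) (fun _ => rfl) (j₂ := c)
      (by rw [hflow]; exact S.Q_pos_of_rate_pos edge.down)
    simpa only [zero_apply, add_zero, S.Phi_zero] using hstep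

theorem compositeFlow {m : ℕ} (i : Fin (m + 1) → E) {u : Fin m → ℝ} (hu : ∀ k, 0 < u k)
    (l : Fin m → V →L[ℝ] ℝ) :
    S.Reaches x₀ j₀ (i (Fin.last m)) (fun w => S.compositeFlow i (fun k => u k + l k w) x₀)
      fun w => ∑ k, (u k + l k w) := by
  induction m with
  | zero => simpa only [SwitchedSystem.compositeFlow, Finset.sum_of_isEmpty] using
      (refl (V := V)).switch (i (Fin.last 0))
  | succ m ih =>
    have h := ih (Fin.init i) (u := Fin.init u) (fun k => hu k.castSucc) (Fin.init l)
    simp only [Fin.sum_univ_castSucc]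
    exact (h.wait (hu (Fin.last m)) (l (Fin.last m))).switch (i (Fin.last (m + 1)))

theorem endpoint {m : ℕ} (i : Fin (m + 1) → E) {u : Fin m → ℝ} (hu : ∀ k, 0 < u k) {t : ℝ}
    (ht : ∑ k, u k < t) (j₁ : E) :
    S.Reaches x₀ j₀ j₁ (fun w : Fin m → ℝ => S.endpoint i ((x₀, t), u + w)) fun _ => t := by
  let l (k : Fin m) : (Fin m → ℝ) →L[ℝ] ℝ := ContinuousLinearMap.proj k
  have h := ((compositeFlow (x₀ := x₀) (j₀ := j₀) i hu l).wait (sub_pos.2 ht) (-∑ k, l k)).switch j₁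
  have hlast (w : Fin m → ℝ) : t - ∑ k, u k + (-∑ k, l k) w = t - ∑ k, (u + w) k := by
    simp only [l, neg_apply, sum_apply,
      ContinuousLinearMap.proj_apply, Pi.add_apply, Finset.sum_add_distrib]
    ring
  have hsum (w : Fin m → ℝ) : ∑ k, (u k + l k w) = ∑ k, (u + w) k := rfl
  simp only [hlast, hsum, add_sub_cancel] at h
  exact h

end Reaches

theorem exists_affine_itinerary {m : ℕ} (i : Fin (m + 1) → E) (x₀ : S.M) {u : Fin m → ℝ}
    (hu : ∀ k, 0 < u k) {t : ℝ} (ht : ∑ k, u k < t) (j₀ j₁ : E) :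
    ∃ (n : ℕ) (j : Fin (n + 1) → E) (τ : Fin n → ℝ) (D : (Fin m → ℝ) →L[ℝ] (Fin n → ℝ)),
      j 0 = j₀ ∧ j (Fin.last n) = j₁ ∧ (∀ k, 0 ≤ τ k) ∧ (∀ k, τ k = 0 → ∀ w, D w k = 0) ∧
        0 < S.chainDensity x₀ j τ ∧ (∀ w, ∑ k, (τ + D w) k = t) ∧
        ∀ w, S.endpoint j ((x₀, t), τ + D w) = S.endpoint i ((x₀, t), u + w) := by
  obtain ⟨n, j, τ, D, hj₀, hj₁, hτ, hD, hdens, hf, hσ⟩ :=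
    Reaches.endpoint i (x₀ := x₀) (j₀ := j₀) hu ht j₁
  refine ⟨n, j, τ, D, hj₀, hj₁, hτ, hD, hdens, hσ, fun w => ?_⟩
  refine Eq.trans ?_ (hf w)
  have hsum : ∑ k, (τ + D w) k = t := hσ w
  rw [endpoint, hsum, sub_self, S.Phi_zero]

end Reaches

end SwitchedSystem

theorem isOpen_pos_sum_lt {ι : Type*} [Fintype ι] (t : ℝ) :
    IsOpen {v : ι → ℝ | (∀ k, 0 < v k) ∧ ∑ k, v k < t} := by
  have hpos : IsOpen {v : ι → ℝ | ∀ k, 0 < v k} := by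
    rw [ofPred_forall]
    exact isOpen_iInter_of_finite fun k => isOpen_lt continuous_const (continuous_apply k)
  have hsum : IsOpen {v : ι → ℝ | ∑ k, v k < t} := isOpen_lt (by fun_prop) continuous_const
  exact hpos.inter hsum

theorem mem_closure_pos_sum_lt {ι : Type*} [Fintype ι] {τ : ι → ℝ} (hτ : ∀ k, 0 ≤ τ k)
    (hsum : 0 < ∑ k, τ k) : τ ∈ closure {v | (∀ k, 0 < v k) ∧ ∑ k, v k < ∑ k, τ k} := by
  have hpath : Continuous fun ε : ℝ => (fun k => (1 - ε) * τ k + ε ^ 2 : ι → ℝ) := by fun_prop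
  have hlim : Tendsto (fun ε : ℝ => (fun k => (1 - ε) * τ k + ε ^ 2 : ι → ℝ)) (𝓝[>] 0) (𝓝 τ) :=
    (hpath.tendsto' 0 τ (funext fun k => by ring)).mono_left nhdsWithin_le_nhds
  have hlt : ∀ᶠ ε in 𝓝 (0 : ℝ), ε * Fintype.card ι < ∑ k, τ k :=
    (continuous_mul_const (Fintype.card ι : ℝ)).continuousAt.eventually_lt_const
      (by simpa only [zero_mul] using hsum)
  refine mem_closure_of_tendsto hlim ?_
  filter_upwards [nhdsWithin_le_nhds hlt, Ioo_mem_nhdsGT one_pos] with ε hε hε₀₁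
  have hone_sub : 0 < 1 - ε := sub_pos.2 hε₀₁.2
  refine ⟨fun k => add_pos_of_nonneg_of_pos (mul_nonneg hone_sub.le (hτ k)) (pow_pos hε₀₁.1 2), ?_⟩
  calc ∑ k, ((1 - ε) * τ k + ε ^ 2)
      = ∑ k, τ k - ε * (∑ k, τ k - ε * Fintype.card ι) := by
        rw [Finset.sum_add_distrib, ← Finset.mul_sum, Finset.sum_const, Finset.card_univ,
          nsmul_eq_mul]
        ring
    _ < ∑ k, τ k := sub_lt_self _ (mul_pos hε₀₁.1 (sub_pos.2 hε))

theorem exists_pos_of_eventually_nhds {ι : Type*} [Finite ι] {u : ι → ℝ} (hu : ∀ k, 0 ≤ u k)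
    {p : (ι → ℝ) → Prop} (hp : ∀ᶠ v in 𝓝 u, p v) :
    ∃ v, p v ∧ (∀ k, 0 < v k) ∧ ((∀ k, 0 < u k) → v = u) := by
  by_cases hpos : ∀ k, 0 < u k
  · exact ⟨u, hp.self_of_nhds, hpos, fun _ => rfl⟩
  · have hpath : Continuous fun b : ℝ => (fun k => u k + b : ι → ℝ) := by fun_prop
    have hlim : Tendsto (fun b : ℝ => (fun k => u k + b : ι → ℝ)) (𝓝[>] 0) (𝓝 u) :=
      (hpath.tendsto' 0 u (funext fun k => add_zero _)).mono_left nhdsWithin_le_nhds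
    obtain ⟨b, hb, hb₀⟩ := ((hlim.eventually hp).and self_mem_nhdsWithin).exists
    exact ⟨_, hb, fun k => add_pos_of_nonneg_of_pos (hu k) hb₀, fun h => absurd h hpos⟩

theorem eventually_add_mem_of_pos_of_sum_lt {V ι : Type*} [NormedAddCommGroup V] [NormedSpace ℝ V]
    [Fintype ι] {τ : ι → ℝ} (hτ : ∀ k, 0 ≤ τ k) {R : V →L[ℝ] (ι → ℝ)}
    (hR : ∀ k, τ k = 0 → ∀ a, R a k = 0) (hRsum : ∀ a, ∑ k, R a k = 0) {B : Set (ι → ℝ)}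
    (hB : B ∈ 𝓝 τ) (t : ℝ) :
    ∀ᶠ q in 𝓝 (τ, (0 : V)), q.1 ∈ {v | (∀ k, 0 < v k) ∧ ∑ k, v k < t} →
      q.1 + R q.2 ∈ B ∩ {v | 0 ≤ v ∧ ∑ k, v k ≤ t} := by
  have hlim : Tendsto (fun q : (ι → ℝ) × V => q.1 + R q.2) (𝓝 (τ, 0)) (𝓝 τ) := by
    have hcont : Continuous fun q : (ι → ℝ) × V => q.1 + R q.2 := by fun_prop
    exact hcont.tendsto' _ _ (by rw [map_zero, add_zero])
  have hpos : ∀ᶠ v in 𝓝 τ, ∀ k, 0 < τ k → 0 < v k :=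
    eventually_all.2 fun k => eventually_imp_distrib_left.2 fun hk =>
      (continuous_apply k).continuousAt.eventually_const_lt hk
  filter_upwards [hlim.eventually hB, hlim.eventually hpos] with ⟨v, a⟩ hmem hpos' hv
  refine ⟨hmem, fun k => ?_, ?_⟩
  · rcases (hτ k).eq_or_lt' with hk | hk
    · rw [Pi.add_apply, hR k hk a, add_zero]
      exact (hv.1 k).le
    · exact (hpos' k hk).le
  · simp only [Pi.add_apply, Finset.sum_add_distrib, hRsum, add_zero]
    exact hv.2.le

theorem exists_mem_nhds_forall_mem_Icc_of_eventually {X : Type*} [TopologicalSpace X] {M : Set X}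
    {x₀ : M} {t₀ : ℝ≥0} {p : M → ℝ≥0 → Prop}
    (h : ∀ᶠ q : M × ℝ≥0 in 𝓝 x₀ ×ˢ 𝓝[≥] t₀, p q.1 q.2) :
    ∃ U ∈ 𝓝 (x₀ : X), ∃ ε > 0, ∀ x : M, (x : X) ∈ U → ∀ t ∈ Icc t₀ (t₀ + ε), p x t := by
  obtain ⟨U', hU', T, hT, hUT⟩ := mem_prod_iff.1 h
  rw [nhds_subtype_eq_comap] at hU'
  obtain ⟨U, hU, hUU'⟩ := hU'
  obtain ⟨t₁, ht₁, htT⟩ := mem_nhdsGE_iff_exists_Icc_subset.1 hT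
  refine ⟨U, hU, t₁ - t₀, tsub_pos_of_lt ht₁, fun x hx t ht => hUT (mk_mem_prod (hUU' hx) (htT ?_))⟩
  rwa [add_tsub_cancel_of_le ht₁.le] at ht

namespace SwitchedSystem

section AbsoluteContinuity

variable {d : ℕ} {E : Type*} [Fintype E] [DecidableEq E] [MeasurableSpace E]
  [MeasurableSingletonClass E] (S : SwitchedSystem d E)

theorem exists_ofReal_mul_volume_le_pathLaw_Z {x₀ : S.M} {n : ℕ} {j : Fin (n + 1) → E}
    {τ : Fin n → ℝ} (hτ : 0 < S.chainDensity x₀ j τ) (t₀ : ℝ≥0) :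
    ∃ b > 0, ∃ B ∈ 𝓝 τ, ∀ᶠ q : S.M × ℝ≥0 in 𝓝 x₀ ×ˢ 𝓝 t₀,
      ∀ A : Set (EuclideanSpace ℝ (Fin d)), MeasurableSet A →
        ENNReal.ofReal b * volume (B ∩ {v : Fin n → ℝ | 0 ≤ v ∧ ∑ k, v k ≤ q.2} ∩
            (fun v => S.endpoint j ((q.1, q.2), v)) ⁻¹' A) ≤
          S.pathLaw q.1 (j 0) {w | ((S.Z q.2 w).1 : EuclideanSpace ℝ (Fin d)) ∈ A ∧
            (S.Z q.2 w).2 = j (Fin.last n)} := by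
  set p := S.chainDensity x₀ j τ / 2
  have hdens : ∀ᶠ r : S.M × (Fin n → ℝ) in 𝓝 (x₀, τ), p < S.chainDensity r.1 j r.2 :=
    (S.continuous_chainDensity j).continuousAt.eventually_const_lt (half_lt_self hτ)
  rw [nhds_prod_eq] at hdens
  obtain ⟨U, hU, B, hB, hUB⟩ := mem_prod_iff.1 hdens
  refine ⟨Real.exp (-(S.lam * (t₀ + 1))) * p, by positivity, B, hB, ?_⟩
  have ht : ∀ᶠ t in 𝓝 t₀, t ≤ t₀ + 1 := Iic_mem_nhds (lt_add_one t₀)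
  filter_upwards [prod_mem_prod hU ht] with ⟨x, t⟩ ⟨hx, ht⟩ A hA
  have hexp : Real.exp (-(S.lam * (t₀ + 1))) ≤ Real.exp (-(S.lam * t)) := by
    have := S.lam_pos
    gcongr
    exact_mod_cast ht
  refine le_trans ?_ (S.setLIntegral_chainDensity_le_pathLaw_Z x j t hA)
  rw [ENNReal.ofReal_mul (Real.exp_nonneg _), mul_assoc, ← setLIntegral_const, inter_assoc]
  refine mul_le_mul' (ENNReal.ofReal_le_ofReal hexp) ((setLIntegral_mono ?_ fun v hv => ?_).trans
    (lintegral_mono_set inter_subset_right))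
  · exact ((S.continuous_chainDensity j).comp (Continuous.prodMk_right x)).measurable.ennreal_ofReal
  · exact ENNReal.ofReal_le_ofReal (hUB (mk_mem_prod hx hv.1)).le

theorem exists_ofReal_mul_volume_inter_ball_le_pathLaw {x₀ : S.M} {n : ℕ} {j : Fin (n + 1) → E}
    {τ : Fin n → ℝ} (hτ : ∀ k, 0 ≤ τ k) (hdens : 0 < S.chainDensity x₀ j τ) {t₀ : ℝ≥0}
    (ht₀ : 0 < t₀) (hsum : ∑ k, τ k = t₀) {R : EuclideanSpace ℝ (Fin d) →L[ℝ] (Fin n → ℝ)}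
    (hR : ∀ a, fderiv ℝ (S.endpoint j) ((x₀, t₀), τ) (0, R a) = a)
    (hR₀ : ∀ k, τ k = 0 → ∀ a, R a k = 0) (hRsum : ∀ a, ∑ k, R a k = 0) :
    ∃ c > 0, ∃ r > 0, ∀ᶠ q : S.M × ℝ≥0 in 𝓝 x₀ ×ˢ 𝓝[≥] t₀,
      ∀ A : Set (EuclideanSpace ℝ (Fin d)), MeasurableSet A →
        ENNReal.ofReal c * volume (A ∩ Metric.ball (S.endpoint j ((x₀, t₀), τ)) r) ≤
          S.pathLaw q.1 (j 0) {w | ((S.Z q.2 w).1 : EuclideanSpace ℝ (Fin d)) ∈ A ∧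
            (S.Z q.2 w).2 = j (Fin.last n)} := by
  obtain ⟨b, hb, B, hB, hpath⟩ := S.exists_ofReal_mul_volume_le_pathLaw_Z hdens t₀
  have hclosure : τ ∈ closure {v | (∀ k, 0 < v k) ∧ ∑ k, v k < (t₀ : ℝ)} :=
    hsum ▸ mem_closure_pos_sum_lt hτ (hsum ▸ NNReal.coe_pos.2 ht₀)
  obtain ⟨c, hc, r, hr, hpush⟩ := exists_ofReal_mul_measure_inter_ball_le volume volume
    (fun p => ((S.contDiff_endpoint j).continuous.comp (Continuous.prodMk_right p)).measurable)
    ((S.contDiff_endpoint j).contDiffAt.hasStrictFDerivAt one_ne_zero) hR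
    (isOpen_pos_sum_lt _) hclosure
    (eventually_add_mem_of_pos_of_sum_lt hτ hR₀ hRsum hB t₀)
  have hcoe : Tendsto (fun q : S.M × ℝ≥0 => ((q.1 : EuclideanSpace ℝ (Fin d)), (q.2 : ℝ)))
      (𝓝 x₀ ×ˢ 𝓝[≥] t₀) (𝓝 (x₀, t₀)) := by
    have hcont : Continuous fun q : S.M × ℝ≥0 =>
        ((q.1 : EuclideanSpace ℝ (Fin d)), (q.2 : ℝ)) := by fun_prop
    refine (hcont.tendsto (x₀, t₀)).mono_left ?_
    rw [nhds_prod_eq]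
    exact prod_mono le_rfl nhdsWithin_le_nhds
  have hle : ∀ᶠ q : S.M × ℝ≥0 in 𝓝 x₀ ×ˢ 𝓝[≥] t₀, t₀ ≤ q.2 :=
    tendsto_snd.eventually self_mem_nhdsWithin
  refine ⟨b * c, mul_pos hb hc, r, hr, ?_⟩
  filter_upwards [hcoe.eventually hpush, prod_mono le_rfl nhdsWithin_le_nhds hpath, hle] with
    ⟨x, t⟩ hpush hpath hle A hA
  calc ENNReal.ofReal (b * c) * volume (A ∩ Metric.ball (S.endpoint j ((x₀, t₀), τ)) r)
      = ENNReal.ofReal b * (ENNReal.ofReal c *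
          volume (A ∩ Metric.ball (S.endpoint j ((x₀, t₀), τ)) r)) := by
        rw [ENNReal.ofReal_mul hb.le, mul_assoc]
    _ ≤ ENNReal.ofReal b * volume (B ∩ {v : Fin n → ℝ | 0 ≤ v ∧ ∑ k, v k ≤ (t₀ : ℝ)} ∩
          (fun v => S.endpoint j ((x, t), v)) ⁻¹' A) := by
        gcongr
        exact hpush A hA
    _ ≤ ENNReal.ofReal b * volume (B ∩ {v : Fin n → ℝ | 0 ≤ v ∧ ∑ k, v k ≤ (t : ℝ)} ∩
          (fun v => S.endpoint j ((x, t), v)) ⁻¹' A) := by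
        gcongr
    _ ≤ _ := hpath A hA

theorem eventually_ofReal_mul_volume_inter_ball_le_pathLaw {x₀ : S.M} {m : ℕ}
    {i : Fin (m + 1) → E} {u : Fin m → ℝ} (hu : ∀ k, 0 < u k) {t₀ : ℝ≥0} (ht₀ : ∑ k, u k < t₀)
    (hsub : Function.Surjective (fderiv ℝ (fun v => S.endpoint i ((x₀, t₀), v)) u)) (j₀ j₁ : E) :
    ∀ᶠ b in 𝓝[>] (0 : ℝ), ∀ᶠ q : S.M × ℝ≥0 in 𝓝 x₀ ×ˢ 𝓝[≥] t₀,
      ∀ A : Set (EuclideanSpace ℝ (Fin d)), MeasurableSet A →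
        ENNReal.ofReal b * volume (A ∩ Metric.ball (S.endpoint i ((x₀, t₀), u)) b) ≤
          S.pathLaw q.1 j₀ {w | ((S.Z q.2 w).1 : EuclideanSpace ℝ (Fin d)) ∈ A ∧
            (S.Z q.2 w).2 = j₁} := by
  obtain ⟨n, j, τ, D, rfl, rfl, hτ, hD, hdens, hsum, hend⟩ :=
    S.exists_affine_itinerary i x₀ hu ht₀ j₀ j₁
  obtain ⟨R₀, hR₀⟩ := exists_continuousLinearMap_rightInverse hsub
  have hτsum : ∑ k, τ k = t₀ := by
    have h := hsum 0
    rwa [map_zero, add_zero] at h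
  have hDsum (w : Fin m → ℝ) : ∑ k, D w k = 0 := by
    have h := hsum w
    simpa only [Pi.add_apply, Finset.sum_add_distrib, hτsum, add_eq_left] using h
  have hz : S.endpoint j ((x₀, t₀), τ) = S.endpoint i ((x₀, t₀), u) := by
    have h := hend 0
    rwa [map_zero, add_zero, add_zero] at h
  have hderiv (w : Fin m → ℝ) : fderiv ℝ (S.endpoint j) ((x₀, t₀), τ) (0, D w) =
      fderiv ℝ (fun v => S.endpoint i ((x₀, t₀), v)) u w := by
    have hi : DifferentiableAt ℝ (fun v => S.endpoint i ((x₀, t₀), v)) u :=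
      ((S.contDiff_endpoint i).comp (contDiff_prodMk_right _)).differentiable one_ne_zero u
    have hj : DifferentiableAt ℝ (S.endpoint j) ((x₀, t₀), τ) :=
      (S.contDiff_endpoint j).differentiable one_ne_zero _
    rw [← hi.lineDeriv_eq_fderiv, ← hj.lineDeriv_eq_fderiv, lineDeriv, lineDeriv]
    simp only [Prod.smul_mk, smul_zero, Prod.mk_add_mk, add_zero, ← map_smul, hend]
  have ht₀_pos : 0 < t₀ :=
    NNReal.coe_pos.1 ((Finset.sum_nonneg fun k _ => (hu k).le).trans_lt ht₀)
  obtain ⟨c, hc, r, hr, hle⟩ := S.exists_ofReal_mul_volume_inter_ball_le_pathLaw hτ hdens ht₀_pos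
    hτsum (R := D.comp R₀) (fun a => (hderiv _).trans (hR₀ a)) (fun k hk a => hD k hk (R₀ a))
    (fun a => hDsum (R₀ a))
  filter_upwards [Ioo_mem_nhdsGT (lt_min hc hr)] with b hb
  filter_upwards [hle] with q hq A hA
  refine le_trans ?_ (hq A hA)
  rw [hz]
  gcongr
  · exact hb.2.le.trans (min_le_left _ _)
  · exact hb.2.le.trans (min_le_right _ _)

theorem exists_ball_ofReal_mul_volume_le_pathLaw {x₀ : S.M} {m : ℕ} {i : Fin (m + 1) → E}
    {u : Fin m → ℝ} (hu : ∀ k, 0 < u k) {t₀ : ℝ≥0} (ht₀ : ∑ k, u k < t₀)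
    (hsub : Function.Surjective (fderiv ℝ (fun v => S.endpoint i ((x₀, t₀), v)) u))
    {W : Set (EuclideanSpace ℝ (Fin d))} (hW : W ∈ 𝓝 (S.endpoint i ((x₀, t₀), u))) :
    ∃ b > 0, Metric.ball (S.endpoint i ((x₀, t₀), u)) b ⊆ W ∧
      ∃ U ∈ 𝓝 (x₀ : EuclideanSpace ℝ (Fin d)), ∃ ε > 0, ∀ x : S.M,
        (x : EuclideanSpace ℝ (Fin d)) ∈ U → ∀ t ∈ Icc t₀ (t₀ + ε), ∀ j₀ j₁ : E,
          ∀ A : Set (EuclideanSpace ℝ (Fin d)), MeasurableSet A →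
            ENNReal.ofReal b * volume (A ∩ Metric.ball (S.endpoint i ((x₀, t₀), u)) b) ≤
              S.pathLaw x j₀
                {w | ((S.Z t w).1 : EuclideanSpace ℝ (Fin d)) ∈ A ∧ (S.Z t w).2 = j₁} := by
  obtain ⟨r, hr, hrW⟩ := Metric.mem_nhds_iff.1 hW
  have hmodes := eventually_all.2 fun j₀ => eventually_all.2 fun j₁ =>
    S.eventually_ofReal_mul_volume_inter_ball_le_pathLaw hu ht₀ hsub j₀ j₁
  obtain ⟨b, hle, hb⟩ := (hmodes.and (Ioo_mem_nhdsGT hr)).exists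
  exact ⟨b, hb.1, (Metric.ball_subset_ball hb.2.le).trans hrW,
    exists_mem_nhds_forall_mem_Icc_of_eventually
      (eventually_all.2 fun j₀ => eventually_all.2 fun j₁ => hle j₀ j₁)⟩

end AbsoluteContinuity

end SwitchedSystem

theorem mainTheorem5 {d : ℕ} (hd : 1 ≤ d) {E : Type*} [Fintype E] [DecidableEq E]
    [MeasurableSpace E] [MeasurableSingletonClass E] (S : SwitchedSystem d E)
    (x₀ y : EuclideanSpace ℝ (Fin d)) (hx₀ : x₀ ∈ S.M)
    {m : ℕ} (i : Fin (m + 1) → E) (u : Fin m → ℝ) (hu : ∀ k, 0 ≤ u k)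
    (hy : S.compositeFlow i u x₀ = y)
    (hsub : ∃ s : ℝ, ∑ k, u k < s ∧
      SubmersionAt
        (fun v => S.Phi (i (Fin.last m)) (s - ∑ k, v k) (S.compositeFlow i v x₀)) u)
    (t₀ : ℝ≥0) (ht₀ : ∑ k, u k < t₀) :
    ∀ W ∈ 𝓝 (S.Phi (i (Fin.last m)) (t₀ - ∑ k, u k) y),
      ∃ U₀ ∈ 𝓝 x₀, ∃ V : Set (EuclideanSpace ℝ (Fin d)),
        IsOpen V ∧ V.Nonempty ∧ V ⊆ W ∧
        ((∀ k, 0 < u k) → S.Phi (i (Fin.last m)) (t₀ - ∑ k, u k) y ∈ V) ∧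
        ∃ c : ℝ, 0 < c ∧ ∃ ε : ℝ≥0, 0 < ε ∧
          ∀ x : S.M, (x : EuclideanSpace ℝ (Fin d)) ∈ U₀ → ∀ j₀ j : E,
            ∀ t ∈ Icc t₀ (t₀ + ε), ∀ A : Set (EuclideanSpace ℝ (Fin d)), MeasurableSet A →
              ENNReal.ofReal c * volume (A ∩ V) ≤
                S.pathLaw x j₀
                  {w | ((S.Z t w).1 : EuclideanSpace ℝ (Fin d)) ∈ A ∧ (S.Z t w).2 = j} := by
  subst hy
  intro W hW
  obtain ⟨s, -, -, hs⟩ := hsub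
  have hend : ContDiff ℝ 1 fun v => S.endpoint i ((x₀, t₀), v) :=
    (S.contDiff_endpoint i).comp (contDiff_prodMk_right _)
  have hsurj : ∀ᶠ v in 𝓝 u, Function.Surjective
      (fderiv ℝ (fun v => S.endpoint i ((x₀, t₀), v)) v) :=
    (hend.continuous_fderiv one_ne_zero).continuousAt.eventually
      (eventually_surjective (S.surjective_fderiv_endpoint i x₀ t₀ hs))
  have hsum : ∀ᶠ v in 𝓝 u, ∑ k, v k < (t₀ : ℝ) :=
    (continuous_finsetSum _ fun k _ => continuous_apply k).continuousAt.eventually_lt_const ht₀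
  have hnhds : ∀ᶠ v in 𝓝 u, W ∈ 𝓝 (S.endpoint i ((x₀, t₀), v)) :=
    hend.continuous.continuousAt.eventually (eventually_mem_nhds_iff.2 hW)
  obtain ⟨v, ⟨hsurj, hsum, hnhds⟩, hv, hvu⟩ :=
    exists_pos_of_eventually_nhds hu (hsurj.and (hsum.and hnhds))
  obtain ⟨b, hb, hbW, U₀, hU₀, ε, hε, h⟩ :=
    S.exists_ball_ofReal_mul_volume_le_pathLaw (x₀ := ⟨x₀, hx₀⟩) hv hsum hsurj hnhds
  refine ⟨U₀, hU₀, _, Metric.isOpen_ball, ⟨_, Metric.mem_ball_self hb⟩, hbW, fun hpos => ?_,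
    b, hb, ε, hε, fun x hx j₀ j t ht => h x hx t ht j₀ j⟩
  rw [hvu hpos]
  exact Metric.mem_ball_self hb
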